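/- **Setting.** All Hilbert spaces are finite-dimensional with fixed orthonormal bases, $M_N=B(\mathbb C^N)$, and $\|\cdot\|$ on matrices is the operator norm. A *quantum operation* on $B(\mathcal H)$ is a completely positive trace-preserving linear map $B(\mathcal H)\to B(\mathcal H)$. A *rank-one quantum game* $G=G(|\psi\rangle,|\gamma\rangle)$ is given by unit vectors $|\psi\rangle,|\gamma\rangle\in\mathcal H_A\otimes\mathcal H_B\otimes\mathcal H_C$. The referee prepares $|\psi\rangle$, sends the registers $A$ and $B$ to the players Alice and Bob, receives registers $A$ and $B$ back, and measures $ABC$ with $\{|\gamma\rangle\langle\gamma|,\,1-|\gamma\rangle\langle\gamma|\}$; the players win if the outcome is $|\gamma\rangle\langle\gamma|$. So, if $\rho$ is the final state of $ABC$ and the players' auxiliary system $E$, the winning probability is $\mathrm{tr}\big((|\gamma\rangle\langle\gamma|\otimes 1_E)\rho\big)$. * The *entangled value* $\omega^*(G)$ is the supremum of the winning probability over all finite-dimensional $\mathcal H_{A'},\mathcal H_{B'}$, all shared unit vectors $|\phi\rangle\in\mathcal H_{A'}\otimes\mathcal H_{B'}$ and all quantum operations $T_{AA'}$ on $AA'$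 (Alice) and $T_{BB'}$ on $BB'$ (Bob), applied to $|\psi\rangle|\phi\rangle$. * The *entangled value with one-way communication from Alice to Bob* $\omega_{qow}(G)$ is the supremum of the winning probability over all finite-dimensional $\mathcal H_{A'}\neq 0$, with $A'$ initialized in a fixed basis state $|0\rangle$, and all quantum operations $T_{AA'}$ (applied first, by Alice) and $T_{BA'}$ (applied next, by Bob). * The *maximal value* $V(G)$ is the supremum of the winning probability for a single player holding $A$, $B$ and an arbitrary finite-dimensional auxiliary system $E$ in an arbitrary pure state, who applies an arbitrary quantum operation on $ABE$. **Operator spaces.** For a linear map $T:V\to W$ between operator spaces, $\|T\|_{cb}=\sup_n\|T_n:M_n(V)\to M_n(W)\|$, where $T_n$ acts entrywise; $T$ is a complete contraction if $\|T\|_{cb}\le 1$. $M_N$ has the matrix norms of $M_n(M_N)=M_{nN}$. $R_k$ and $C_k$ are $\mathbb C^k$ with the matrix norms $\|\sum_i A_i\otimes|i\rangle\|=\|\sum_iA_iA_i^*\|^{1/2}$ and $\|\sum_i A_i^*A_i\|^{1/2}$ respectively. $S_1^N$ is the space of $N\times N$ matrices with the operator space structure of the dual $M_N^*$ (where $M_n(V^*)=CB(V,M_n)$)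 under the scalar pairing $\langle b,c\rangle=\sum_{s,t}b_{st}c_{st}$; $S_1^A,S_1^B$ are these spaces for $\mathcal H_A,\mathcal H_B$. For $u\in V\otimes W$, $$\|u\|_{V\otimes_{\min}W}=\sup\big\{\|(T\otimes S)(u)\|_{M_{pq}}:\ p,q\ge1,\ T:V\to M_p,\ S:W\to M_q\text{ complete contractions}\big\},$$ $$\|u\|_{V\otimes_hW}=\inf\Big\{\big\|\textstyle\sum_{i=1}^k|i\rangle\otimes a_i\big\|_{R_k\otimes_{\min}V}\,\big\|\sum_{i=1}^k|i\rangle\otimes b_i\big\|_{C_k\otimes_{\min}W}:\ u=\sum_{i=1}^ka_i\otimes b_i\Big\}.$$ **Theorem.** Let $G=G(|\psi\rangle,|\gamma\rangle)$ be a rank-one quantum game and let $M_{AB}=\mathrm{tr}_C|\psi\rangle\langle\gamma|\in B(\mathcal H_A\otimes\mathcal H_B)=B(\mathcal H_A)\otimes B(\mathcal H_B)$. Then 1. $\omega^*(G)=\|M_{AB}\|^2_{S_1^A\otimes_{\min}S_1^B}$; 2. $\omega_{qow}(G)=\|M_{AB}\|^2_{S_1^A\otimes_hS_1^B}$; 3.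 $V(G)=\|M_{AB}\|^2_{S_1^{AB}}$, where $\|\cdot\|_{S_1^{AB}}$ is the trace norm (sum of singular values) on $B(\mathcal H_A\otimes\mathcal H_B)$. -/

import Mathlib

open scoped ENNReal TensorProduct Kronecker ComplexOrder

noncomputable section

namespace RankOneGames

/-! ### Operator spaces

All Hilbert spaces are finite-dimensional and coordinatized: the space with orthonormal basis
indexed by a finite type `ι` is `EuclideanSpace ℂ ι`, its operators are `Matrix ι ι ℂ`, and the
tensor product of two of them is indexed by the product of the index types.
All norms, suprema and infima are taken in `ℝ≥0∞`, so that none of them has a default value. -/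

/-- The operator norm of a square matrix on the Hilbert space `ℂ^ι`. -/
def opNorm {ι : Type*} [Fintype ι] [DecidableEq ι] (X : Matrix ι ι ℂ) : ℝ≥0∞ :=
  ‖Matrix.toEuclideanCLM (𝕜 := ℂ) X‖ₑ

/-- A sequence of matrix norms on `V`: the data `‖·‖_n` on `M_n(V)`, `n = 0, 1, 2, …`, of an
operator space structure. It is only used for the concrete structures `M_ι`, `R_ι`, `C_ι` and
`S_1^ι` below. -/
abbrev MatrixNorms (V : Type*) := ∀ n : ℕ, Matrix (Fin n) (Fin n) V → ℝ≥0∞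

section General

variable {V W : Type*} [AddCommGroup V] [Module ℂ V] [AddCommGroup W] [Module ℂ W]

/-- The completely bounded norm `sup_n ‖T_n : M_n(V) → M_n(W)‖`. -/
def cbNorm (NV : MatrixNorms V) (NW : MatrixNorms W) (T : V →ₗ[ℂ] W) : ℝ≥0∞ :=
  ⨆ (n : ℕ) (x : Matrix (Fin n) (Fin n) V) (_ : NV n x ≤ 1), NW n (x.map T)

/-- The operator space `M_ι = B(ℂ^ι)`, with `M_n(M_ι) = B(ℂ^n ⊗ ℂ^ι)`. -/
def matNorms (ι : Type*) [Fintype ι] [DecidableEq ι] : MatrixNorms (Matrix ι ι ℂ) :=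
  fun n x => opNorm (Matrix.comp (Fin n) (Fin n) ι ι ℂ x)

/-- The column operator space `C_ι`: `‖∑ i, A i ⊗ |i⟩‖ = ‖∑ i, (A i)ᴴ * A i‖ ^ (1/2)`. -/
def colNorms (ι : Type*) [Fintype ι] : MatrixNorms (ι → ℂ) :=
  fun _ x => opNorm (∑ i, (x.map fun v => v i).conjTranspose * x.map fun v => v i) ^ (1 / 2 : ℝ)

/-- The row operator space `R_ι`: `‖∑ i, A i ⊗ |i⟩‖ = ‖∑ i, A i * (A i)ᴴ‖ ^ (1/2)`. -/
def rowNorms (ι : Type*) [Fintype ι] : MatrixNorms (ι → ℂ) :=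
  fun _ x => opNorm (∑ i, (x.map fun v => v i) * (x.map fun v => v i).conjTranspose) ^ (1 / 2 : ℝ)

/-- The linear map `V → M_n`, `v ↦ (x_ij(v))_ij`, given by a matrix `x` of functionals. -/
def dualMatrixMap {n : ℕ} (x : Matrix (Fin n) (Fin n) (Module.Dual ℂ V)) :
    V →ₗ[ℂ] Matrix (Fin n) (Fin n) ℂ where
  toFun v := Matrix.of fun i j => x i j v
  map_add' u v := by ext; simp
  map_smul' c v := by ext; simp

/-- The dual operator space: `M_n(V^*) = CB(V, M_n)`. -/
def dualNorms (NV : MatrixNorms V) : MatrixNorms (Module.Dual ℂ V) :=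
  fun n x => cbNorm NV (matNorms (Fin n)) (dualMatrixMap x)

/-- The scalar pairing `⟨b, c⟩ = ∑ s t, b s t * c s t = tr (b cᵀ)`. -/
def scalarPairing {ι : Type*} [Fintype ι] (b : Matrix ι ι ℂ) : Module.Dual ℂ (Matrix ι ι ℂ) where
  toFun c := ∑ s, ∑ t, b s t * c s t
  map_add' c d := by simp [mul_add, Finset.sum_add_distrib]
  map_smul' r c := by simp [Finset.mul_sum, mul_left_comm]

/-- The operator space `S_1^ι = (M_ι)^*`, the identification being the scalar pairing. -/
def s1Norms (ι : Type*) [Fintype ι] [DecidableEq ι] : MatrixNorms (Matrix ι ι ℂ) :=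
  fun n x => dualNorms (matNorms ι) n (x.map scalarPairing)

/-- The linear map `v ⊗ w ↦ T v ⊗ S w ∈ B(ℂ^p ⊗ ℂ^q)`. -/
def tensorMap {p q : ℕ} (T : V →ₗ[ℂ] Matrix (Fin p) (Fin p) ℂ)
    (S : W →ₗ[ℂ] Matrix (Fin q) (Fin q) ℂ) :
    V ⊗[ℂ] W →ₗ[ℂ] Matrix (Fin p × Fin q) (Fin p × Fin q) ℂ :=
  TensorProduct.lift ((Matrix.kroneckerMapBilinear (LinearMap.mul ℂ ℂ)).compl₁₂ T S)

/-- The minimal tensor norm: the supremum of `‖(T ⊗ S) u‖` over all complete contractions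
`T : V → M_p` and `S : W → M_q`. -/
def minNorm (NV : MatrixNorms V) (NW : MatrixNorms W) (u : V ⊗[ℂ] W) : ℝ≥0∞ :=
  ⨆ (p : ℕ) (q : ℕ) (T : V →ₗ[ℂ] Matrix (Fin p) (Fin p) ℂ)
    (S : W →ₗ[ℂ] Matrix (Fin q) (Fin q) ℂ)
    (_ : cbNorm NV (matNorms (Fin p)) T ≤ 1) (_ : cbNorm NW (matNorms (Fin q)) S ≤ 1),
    opNorm (tensorMap T S u)

/-- The Haagerup tensor norm: the infimum of
`‖∑ i, |i⟩ ⊗ a i‖_{R_k ⊗_min V} * ‖∑ i, |i⟩ ⊗ b i‖_{C_k ⊗_min W}` over all ways to write `u` as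
`∑ i, a i ⊗ b i`. -/
def haagerupNorm (NV : MatrixNorms V) (NW : MatrixNorms W) (u : V ⊗[ℂ] W) : ℝ≥0∞ :=
  ⨅ (k : ℕ) (a : Fin k → V) (b : Fin k → W) (_ : u = ∑ i, a i ⊗ₜ[ℂ] b i),
    minNorm (rowNorms (Fin k)) NV (∑ i, (Pi.single i 1 : Fin k → ℂ) ⊗ₜ[ℂ] a i) *
      minNorm (colNorms (Fin k)) NW (∑ i, (Pi.single i 1 : Fin k → ℂ) ⊗ₜ[ℂ] b i)

end General

/-- The trace norm (the norm of `S_1`): the sum of the singular values. -/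
def traceNorm {ι : Type*} [Fintype ι] [DecidableEq ι] (X : Matrix ι ι ℂ) : ℝ≥0∞ :=
  ENNReal.ofReal ((Matrix.toEuclideanLin X).singularValues.sum fun _ s => s)

/-- The identification `B(ℂ^α ⊗ ℂ^β) = B(ℂ^α) ⊗ B(ℂ^β)`. -/
def toTensor {α β : Type*} [Fintype α] [Fintype β] [DecidableEq α] [DecidableEq β]
    (X : Matrix (α × β) (α × β) ℂ) : Matrix α α ℂ ⊗[ℂ] Matrix β β ℂ :=
  ∑ i, ∑ j, ∑ k, ∑ l,
    X (i, k) (j, l) • (Matrix.single i j (1 : ℂ) ⊗ₜ[ℂ] Matrix.single k l (1 : ℂ))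

/-! ### Quantum operations -/

/-- The ampliation `T ⊗ id` of a map `T` on `B(ℂ^m)` to `B(ℂ^m ⊗ ℂ^r)`. -/
def ampliate {m r : Type*} (T : Matrix m m ℂ →ₗ[ℂ] Matrix m m ℂ) (X : Matrix (m × r) (m × r) ℂ) :
    Matrix (m × r) (m × r) ℂ :=
  Matrix.of fun x y => T (Matrix.of fun i j => X (i, x.2) (j, y.2)) x.1 y.1

/-- A quantum operation on `B(ℂ^m)`: a completely positive trace-preserving linear map. -/
structure IsQuantumOperation {m : Type*} [Fintype m]
    (T : Matrix m m ℂ →ₗ[ℂ] Matrix m m ℂ) : Prop where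
  completelyPositive : ∀ (n : ℕ) (X : Matrix (m × Fin n) (m × Fin n) ℂ),
    X.PosSemidef → (ampliate T X).PosSemidef
  tracePreserving : ∀ X, (T X).trace = X.trace

/-- `T` acting on the part `m` of a composite system `N ≃ m × r`, the identity on the rest. -/
def applyOn {N m r : Type*} (e : N ≃ m × r) (T : Matrix m m ℂ →ₗ[ℂ] Matrix m m ℂ)
    (X : Matrix N N ℂ) : Matrix N N ℂ :=
  (ampliate T (X.submatrix e.symm e.symm)).submatrix e e

/-- The rank-one operator `|v⟩⟨v|`. -/
def pureState {ι : Type*} (v : EuclideanSpace ℂ ι) : Matrix ι ι ℂ :=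
  Matrix.of fun i j => v i * star (v j)

/-- The vector `|v⟩|w⟩`. -/
def tensorVec {ι κ : Type*} (v : EuclideanSpace ℂ ι) (w : EuclideanSpace ℂ κ) :
    EuclideanSpace ℂ (ι × κ) :=
  WithLp.toLp 2 fun x => v x.1 * w x.2

/-! ### Rank-one quantum games -/

/-- A rank-one quantum game `G(|ψ⟩, |γ⟩)`: an initial state and a measurement state in
`H_A ⊗ H_B ⊗ H_C`. -/
structure Game (α β χ : Type*) [Fintype α] [Fintype β] [Fintype χ] where
  ψ : EuclideanSpace ℂ (α × β × χ)
  γ : EuclideanSpace ℂ (α × β × χ)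
  norm_ψ : ‖ψ‖ = 1
  norm_γ : ‖γ‖ = 1

namespace Game

variable {α β χ : Type*} [Fintype α] [Fintype β] [Fintype χ]

/-- The operator `M_AB = tr_C |ψ⟩⟨γ|`. -/
def M (G : Game α β χ) : Matrix (α × β) (α × β) ℂ :=
  Matrix.of fun x y => ∑ c, G.ψ (x.1, x.2, c) * star (G.γ (y.1, y.2, c))

/-- The probability `tr ((|γ⟩⟨γ| ⊗ 1_E) ρ)` that the final state `ρ` of the registers `ABC`
and the players' auxiliary system `E` passes the referee's measurement. -/
def winProb (G : Game α β χ) {E : Type*} [Fintype E] [DecidableEq E]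
    (ρ : Matrix ((α × β × χ) × E) ((α × β × χ) × E) ℂ) : ℝ :=
  ((pureState G.γ ⊗ₖ (1 : Matrix E E ℂ)) * ρ).trace.re

/-- Alice's system `AA'` inside `(ABC)(A'B')`. -/
def aliceSplit (α β χ P Q : Type*) :
    (α × β × χ) × (P × Q) ≃ (α × P) × (β × χ × Q) where
  toFun x := ((x.1.1, x.2.1), (x.1.2.1, x.1.2.2, x.2.2))
  invFun y := ((y.1.1, y.2.1, y.2.2.1), (y.1.2, y.2.2.2))
  left_inv _ := rfl
  right_inv _ := rfl

/-- Bob's system `BB'` inside `(ABC)(A'B')`. -/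
def bobSplit (α β χ P Q : Type*) :
    (α × β × χ) × (P × Q) ≃ (β × Q) × (α × χ × P) where
  toFun x := ((x.1.2.1, x.2.2), (x.1.1, x.1.2.2, x.2.1))
  invFun y := ((y.2.1, y.1.1, y.2.2.1), (y.2.2.2, y.1.2))
  left_inv _ := rfl
  right_inv _ := rfl

/-- The system `AA'` inside `(ABC)A'`. -/
def senderSplit (α β χ P : Type*) : (α × β × χ) × P ≃ (α × P) × (β × χ) where
  toFun x := ((x.1.1, x.2), (x.1.2.1, x.1.2.2))
  invFun y := ((y.1.1, y.2.1, y.2.2), y.1.2)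
  left_inv _ := rfl
  right_inv _ := rfl

/-- The system `BA'` inside `(ABC)A'`. -/
def receiverSplit (α β χ P : Type*) : (α × β × χ) × P ≃ (β × P) × (α × χ) where
  toFun x := ((x.1.2.1, x.2), (x.1.1, x.1.2.2))
  invFun y := ((y.2.1, y.1.1, y.2.2), y.1.2)
  left_inv _ := rfl
  right_inv _ := rfl

/-- The system `ABE` inside `(ABC)E`. -/
def jointSplit (α β χ E : Type*) : (α × β × χ) × E ≃ (α × β × E) × χ where
  toFun x := ((x.1.1, x.1.2.1, x.2), x.1.2.2)
  invFun y := ((y.1.1, y.1.2.1, y.2), y.1.2.2)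
  left_inv _ := rfl
  right_inv _ := rfl

/-- The entangled value `ω^*(G)`: Alice and Bob share a state `φ ∈ H_A' ⊗ H_B'` and apply quantum
operations to `AA'` and to `BB'`. -/
def entangledValue (G : Game α β χ) : ℝ≥0∞ :=
  ⨆ (p : ℕ) (q : ℕ) (φ : EuclideanSpace ℂ (Fin p × Fin q))
    (T : Matrix (α × Fin p) (α × Fin p) ℂ →ₗ[ℂ] Matrix (α × Fin p) (α × Fin p) ℂ)
    (S : Matrix (β × Fin q) (β × Fin q) ℂ →ₗ[ℂ] Matrix (β × Fin q) (β × Fin q) ℂ)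
    (_ : ‖φ‖ = 1) (_ : IsQuantumOperation T) (_ : IsQuantumOperation S),
    ENNReal.ofReal (G.winProb
      (applyOn (bobSplit α β χ (Fin p) (Fin q)) S
        (applyOn (aliceSplit α β χ (Fin p) (Fin q)) T (pureState (tensorVec G.ψ φ)))))

/-- The entangled value with one-way communication `ω_qow(G)`: the register `A'` starts in the
state `|0⟩`, Alice applies a quantum operation to `AA'` and sends `A'` to Bob, who then applies a
quantum operation to `BA'`. -/
def oneWayValue (G : Game α β χ) : ℝ≥0∞ :=
  ⨆ (p : ℕ)
    (T : Matrix (α × Fin (p + 1)) (α × Fin (p + 1)) ℂ →ₗ[ℂ]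
      Matrix (α × Fin (p + 1)) (α × Fin (p + 1)) ℂ)
    (S : Matrix (β × Fin (p + 1)) (β × Fin (p + 1)) ℂ →ₗ[ℂ]
      Matrix (β × Fin (p + 1)) (β × Fin (p + 1)) ℂ)
    (_ : IsQuantumOperation T) (_ : IsQuantumOperation S),
    ENNReal.ofReal (G.winProb
      (applyOn (receiverSplit α β χ (Fin (p + 1))) S
        (applyOn (senderSplit α β χ (Fin (p + 1))) T
          (pureState (tensorVec G.ψ (EuclideanSpace.single (0 : Fin (p + 1)) (1 : ℂ)))))))

/-- The maximal value `V(G)`: a single player, who holds both registers `A` and `B` and an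
auxiliary system `E` in a state `φ`, applies a quantum operation to `ABE`. -/
def maximalValue (G : Game α β χ) : ℝ≥0∞ :=
  ⨆ (d : ℕ) (φ : EuclideanSpace ℂ (Fin d))
    (T : Matrix (α × β × Fin d) (α × β × Fin d) ℂ →ₗ[ℂ]
      Matrix (α × β × Fin d) (α × β × Fin d) ℂ)
    (_ : ‖φ‖ = 1) (_ : IsQuantumOperation T),
    ENNReal.ofReal (G.winProb
      (applyOn (jointSplit α β χ (Fin d)) T (pureState (tensorVec G.ψ φ))))

end Game

end RankOneGames

end

/-! Strategies are complete contractions on `S_1`. Encode a map `T : S_1^A → M_{P,P'}` by its block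
matrix `∑ E_st ⊗ T(E_st)`. Because `M_n(S_1) = CB(M_α, M_n)`, `T` is a complete contraction exactly
when the block matrix is a contraction (`isCompleteContraction_of_blockMatrix`,
`IsCompleteContraction.blockMatrix`). On the quantum side, the Kraus operators of an operation stack
to a contraction, and every contraction is one Kraus operator of some operation
(`IsQuantumOperation.exists_krausMap`, `exists_isQuantumOperation_krausMap`). The winning
probability is the sum, over Kraus branches, of the squared norms of the vectors `(⟨γ| ⊗ 1) v`, and
these are contractions of `M_AB` against the Kraus operators.

Entangled value: the amplitude vector is the transpose of `(T ⊗ S)(M_AB)` applied to the shared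
state (`overlap_entangled`). Its norm, over all strategies and all unit states, gives the minimal
tensor norm.

Maximal value: the amplitudes are `tr(M_AB W_y)`, where the `W_y` form a contractive column.
Cauchy–Schwarz reduces the column to a single contraction, and the trace norm is dual to the
operator norm (`exists_traceNorm_eq`).

One-way value: a decomposition `M_AB = ∑ a_i ⊗ b_i` splits the amplitude into a row controlled by
Alice and a column controlled by Bob, which gives the upper bound. For the lower bound, a
contractive row `x` and a contractive column `y` form a strategy with amplitude `∑ ⟨M_AB, x_i ⊗
y_i⟩`, the message being `i`. It remains to see that these numbers reach the Haagerup norm. If all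
of them are below `w`, Hahn–Banach separation (`exists_dual_functional`) yields a positive
functional `f` with `Re⟨M_AB, x ⊗ y⟩ f(1) ≤ w f(x xᴴ, yᴴ y)`. After a small perturbation the right
side is `w (‖D x‖² + ‖F yᴴ‖²)` in Hilbert–Schmidt norms with invertible `D`, `F`. The form thus
factors through Hilbert–Schmidt space, and the factorization is an explicit decomposition of `M_AB`
with row norm at most `‖D‖` and column norm at most a constant times `‖F‖`
(`haagerupNorm_toTensor_le`). -/

set_option linter.unusedSectionVars false

namespace RankOneGames

open Matrix

/-! ### Square norms and bounds on rectangular matrices -/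

section SqBounded

variable {ι κ μ ι' κ' : Type*} [Fintype ι'] [Fintype κ'] [Fintype ι] [Fintype κ] [Fintype μ]

/-- The squared Hilbert space norm of a coordinate vector. -/
noncomputable def normSq (v : ι → ℂ) : ℝ := ∑ i, ‖v i‖ ^ 2

/-- The operator `X` has squared operator norm at most `c`. -/
def SqBounded (c : ℝ) (X : Matrix ι κ ℂ) : Prop := ∀ v, normSq (X *ᵥ v) ≤ c * normSq v

lemma normSq_nonneg (v : ι → ℂ) : 0 ≤ normSq v := Finset.sum_nonneg fun _ _ => by positivity

lemma normSq_zero : normSq (0 : ι → ℂ) = 0 := by simp [normSq]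

lemma normSq_eq_zero {v : ι → ℂ} : normSq v = 0 ↔ v = 0 := by
  rw [normSq, Finset.sum_eq_zero_iff_of_nonneg fun _ _ => by positivity]
  simp [funext_iff]

lemma normSq_smul (c : ℂ) (v : ι → ℂ) : normSq (c • v) = ‖c‖ ^ 2 * normSq v := by
  simp [normSq, mul_pow, Finset.mul_sum]

lemma normSq_star (v : ι → ℂ) : normSq (star v) = normSq v := by simp [normSq]

lemma normSq_toLp (v : ι → ℂ) : ‖WithLp.toLp 2 v‖ ^ 2 = normSq v := by
  simp [EuclideanSpace.norm_sq_eq, normSq]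

lemma norm_sq_eq_normSq (v : EuclideanSpace ℂ ι) : ‖v‖ ^ 2 = normSq v.ofLp := by
  simp [EuclideanSpace.norm_sq_eq, normSq]

lemma star_dotProduct_self (v : ι → ℂ) : star v ⬝ᵥ v = (normSq v : ℂ) := by
  simp [dotProduct, normSq, Complex.conj_mul']

lemma dotProduct_star_self (v : ι → ℂ) : v ⬝ᵥ star v = (normSq v : ℂ) := by
  rw [dotProduct_comm, star_dotProduct_self]

lemma normSq_prod (v : ι × κ → ℂ) : normSq v = ∑ i, normSq fun k => v (i, k) := by
  simp [normSq, Fintype.sum_prod_type]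

lemma normSq_prod_right (v : ι × κ → ℂ) : normSq v = ∑ k, normSq fun i => v (i, k) := by
  simp [normSq, Fintype.sum_prod_type_right]

lemma normSq_comp_le_of_injective {f : ι → κ} (hf : f.Injective) (v : κ → ℂ) :
    normSq (v ∘ f) ≤ normSq v := by
  classical
  rw [normSq, normSq]
  exact (Finset.sum_map Finset.univ ⟨f, hf⟩ fun k => ‖v k‖ ^ 2).symm.trans_le
    (Finset.sum_le_univ_sum_of_nonneg fun _ => by positivity)

/-- The **Cauchy–Schwarz inequality** in coordinates. -/
lemma norm_dotProduct_sq_le (u v : ι → ℂ) : ‖u ⬝ᵥ v‖ ^ 2 ≤ normSq u * normSq v := by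
  have h := norm_inner_le_norm (𝕜 := ℂ) (WithLp.toLp 2 (star u)) (WithLp.toLp 2 v)
  have h2 : inner ℂ (WithLp.toLp 2 (star u)) (WithLp.toLp 2 v) = u ⬝ᵥ v := by
    simp [EuclideanSpace.inner_eq_star_dotProduct, dotProduct_comm]
  rw [h2] at h
  calc _ ≤ _ := pow_le_pow_left₀ (norm_nonneg _) h 2
    _ = _ := by rw [mul_pow, normSq_toLp, normSq_toLp, normSq_star]

/-- The sum of a function supported on the range of an injection. -/
lemma sum_eq_sum_comp_of_injective {M : Type*} [AddCommMonoid M] {f : ι → κ} (hf : f.Injective)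
    (v : κ → M) (h : ∀ k, k ∉ Set.range f → v k = 0) : ∑ k, v k = ∑ i, v (f i) := by
  classical
  exact (Finset.sum_of_injOn f hf.injOn (by simp) (fun k _ hk => h k (by simpa using hk))
    (fun _ _ => rfl)).symm

lemma SqBounded.norm_bilin_sq_le {c : ℝ} {X : Matrix ι κ ℂ} (h : SqBounded c X) (u : ι → ℂ)
    (v : κ → ℂ) : ‖u ⬝ᵥ X *ᵥ v‖ ^ 2 ≤ c * normSq u * normSq v := by
  calc _ ≤ _ := norm_dotProduct_sq_le _ _
    _ ≤ normSq u * (c * normSq v) := mul_le_mul_of_nonneg_left (h v) (normSq_nonneg _)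
    _ = _ := by ring

/-- Testing against the conjugate of `X v` gives `‖Xv‖⁴ ≤ c ‖Xv‖² ‖v‖²`; divide unless `Xv = 0`. -/
lemma SqBounded.of_bilin {c : ℝ} (hc : 0 ≤ c) {X : Matrix ι κ ℂ}
    (h : ∀ u v, ‖u ⬝ᵥ X *ᵥ v‖ ^ 2 ≤ c * normSq u * normSq v) : SqBounded c X := by
  intro v
  have h1 := h (star (X *ᵥ v)) v
  rw [star_dotProduct_self, normSq_star, Complex.norm_real, Real.norm_eq_abs, sq_abs] at h1
  rcases (normSq_nonneg (X *ᵥ v)).eq_or_lt with h0 | h0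
  · rw [← h0]
    exact mul_nonneg hc (normSq_nonneg v)
  · nlinarith

lemma SqBounded.transpose {c : ℝ} (hc : 0 ≤ c) {X : Matrix ι κ ℂ} (h : SqBounded c X) :
    SqBounded c Xᵀ := by
  refine .of_bilin hc fun u v => ?_
  have := h.norm_bilin_sq_le v u
  rw [mulVec_transpose, dotProduct_comm, ← dotProduct_mulVec]
  linarith

lemma SqBounded.map_star {c : ℝ} {X : Matrix ι κ ℂ} (h : SqBounded c X) :
    SqBounded c (X.map star) := by
  intro v
  have h1 : X.map star *ᵥ v = star (X *ᵥ star v) := by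
    ext i; simp [mulVec, dotProduct]
  rw [h1, normSq_star]
  simpa [normSq_star] using h (star v)

lemma SqBounded.conjTranspose {c : ℝ} (hc : 0 ≤ c) {X : Matrix ι κ ℂ} (h : SqBounded c X) :
    SqBounded c Xᴴ :=
  (h.transpose hc).map_star

lemma SqBounded.mono {c d : ℝ} (hcd : c ≤ d) {X : Matrix ι κ ℂ} (h : SqBounded c X) :
    SqBounded d X := fun v =>
  (h v).trans (mul_le_mul_of_nonneg_right hcd (normSq_nonneg v))

lemma SqBounded.mul {c d : ℝ} (hc : 0 ≤ c) {X : Matrix ι κ ℂ} {Y : Matrix κ μ ℂ}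
    (hX : SqBounded c X) (hY : SqBounded d Y) : SqBounded (c * d) (X * Y) := fun v => by
  rw [← mulVec_mulVec]
  calc _ ≤ _ := hX _
    _ ≤ c * (d * normSq v) := mul_le_mul_of_nonneg_left (hY v) hc
    _ = _ := by ring

lemma SqBounded.smul {c : ℝ} {X : Matrix ι κ ℂ} (h : SqBounded c X) (z : ℂ) :
    SqBounded (‖z‖ ^ 2 * c) (z • X) := fun v => by
  rw [smul_mulVec, normSq_smul, mul_assoc]
  exact mul_le_mul_of_nonneg_left (h v) (by positivity)

/-- A matrix supported on a block has the bound of that block. -/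
lemma SqBounded.of_submatrix {c : ℝ} (hc : 0 ≤ c) {Y : Matrix ι' κ' ℂ} {f : ι → ι'} {g : κ → κ'}
    (hf : f.Injective) (hg : g.Injective) (hYf : ∀ i k, i ∉ Set.range f → Y i k = 0)
    (hYg : ∀ i k, k ∉ Set.range g → Y i k = 0) (h : SqBounded c (Y.submatrix f g)) :
    SqBounded c Y := by
  intro v
  have h1 : ∀ i, (Y *ᵥ v) (f i) = (Y.submatrix f g *ᵥ (v ∘ g)) i := fun i => by
    simp only [mulVec, dotProduct]
    exact sum_eq_sum_comp_of_injective hg _ fun k hk => by simp [hYg _ _ hk]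
  have h2 : normSq (Y *ᵥ v) = normSq (Y.submatrix f g *ᵥ (v ∘ g)) := by
    simp only [normSq, ← h1]
    exact sum_eq_sum_comp_of_injective hf _ fun k hk => by simp [mulVec, dotProduct, hYf _ _ hk]
  rw [h2]
  exact (h _).trans (mul_le_mul_of_nonneg_left (normSq_comp_le_of_injective hg v) hc)

/-- A block of a matrix has the bound of the matrix. -/
lemma SqBounded.submatrix {c : ℝ} {Y : Matrix ι' κ' ℂ} (h : SqBounded c Y) {f : ι → ι'}
    {g : κ → κ'} (hf : f.Injective) (hg : g.Injective) : SqBounded c (Y.submatrix f g) := by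
  intro v
  have hext : ∀ i, Function.extend g v 0 (g i) = v i := fun i => hg.extend_apply v 0 i
  have h0 : ∀ k, k ∉ Set.range g → Function.extend g v 0 k = 0 := fun k hk =>
    Function.extend_apply' v (0 : κ' → ℂ) k hk
  have h1 : Y.submatrix f g *ᵥ v = (Y *ᵥ Function.extend g v 0) ∘ f := by
    ext i
    simp only [mulVec, dotProduct, Function.comp]
    rw [sum_eq_sum_comp_of_injective hg _ fun k hk => by rw [h0 k hk, mul_zero]]
    simp [hext]
  have h2 : normSq (Function.extend g v 0) = normSq v := by
    simp only [normSq]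
    rw [sum_eq_sum_comp_of_injective hg _ fun k hk => by rw [h0 k hk]; simp]
    simp [hext]
  rw [h1, ← h2]
  exact (normSq_comp_le_of_injective hf _).trans (h _)

lemma sqBounded_submatrix_equiv {c : ℝ} {Y : Matrix ι' κ' ℂ} (e : ι ≃ ι') (e' : κ ≃ κ') :
    SqBounded c (Y.submatrix e e') ↔ SqBounded c Y :=
  ⟨fun h => by simpa using h.submatrix e.symm.injective e'.symm.injective,
    fun h => h.submatrix e.injective e'.injective⟩

lemma normSq_mulVec (X : Matrix ι κ ℂ) (v : κ → ℂ) :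
    (normSq (X *ᵥ v) : ℂ) = star v ⬝ᵥ (Xᴴ * X) *ᵥ v := by
  rw [← star_dotProduct_self, star_mulVec, dotProduct_mulVec, dotProduct_mulVec, vecMul_vecMul]

/-- Since `‖Xv‖² = ⟨v, XᴴX v⟩`, Cauchy–Schwarz bounds `‖Xv‖⁴` by `‖v‖⁴`. This turns the square-root
norms of `R` and `C` into contractivity of a stacked row or column. -/
lemma sqBounded_one_iff_gram {X : Matrix ι κ ℂ} : SqBounded 1 (Xᴴ * X) ↔ SqBounded 1 X := by
  refine ⟨fun h v => ?_, fun h => by simpa using (h.conjTranspose zero_le_one).mul zero_le_one h⟩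
  have h1 := h.norm_bilin_sq_le (star v) v
  rw [← normSq_mulVec, Complex.norm_real, Real.norm_eq_abs, sq_abs, normSq_star] at h1
  rw [one_mul] at *
  exact le_of_sq_le_sq (h1.trans_eq (by ring)) (normSq_nonneg v)

/-! ### Comparison with the operator norm. -/

section OpNorm

variable [DecidableEq ι]

lemma opNorm_eq_ofReal (X : Matrix ι ι ℂ) :
    opNorm X = ENNReal.ofReal ‖Matrix.toEuclideanCLM (𝕜 := ℂ) X‖ := by
  rw [opNorm, ofReal_norm]

lemma normSq_mulVec_eq_norm (X : Matrix ι ι ℂ) (v : ι → ℂ) :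
    normSq (X *ᵥ v) = ‖Matrix.toEuclideanCLM (𝕜 := ℂ) X (WithLp.toLp 2 v)‖ ^ 2 := by
  rw [Matrix.toEuclideanCLM_toLp, normSq_toLp]

lemma sqBounded_norm (X : Matrix ι ι ℂ) :
    SqBounded (‖Matrix.toEuclideanCLM (𝕜 := ℂ) X‖ ^ 2) X := fun v => by
  rw [normSq_mulVec_eq_norm, ← normSq_toLp v, ← mul_pow]
  exact pow_le_pow_left₀ (norm_nonneg _) (ContinuousLinearMap.le_opNorm _ _) 2

lemma opNorm_le_ofReal_iff {c : ℝ} (hc : 0 ≤ c) {X : Matrix ι ι ℂ} :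
    opNorm X ≤ ENNReal.ofReal c ↔ SqBounded (c ^ 2) X := by
  rw [opNorm_eq_ofReal, ENNReal.ofReal_le_ofReal_iff hc]
  refine ⟨fun h => (sqBounded_norm X).mono (pow_le_pow_left₀ (norm_nonneg _) h 2), fun h => ?_⟩
  refine ContinuousLinearMap.opNorm_le_bound _ hc fun v => ?_
  refine le_of_sq_le_sq ?_ (by positivity)
  rw [mul_pow, norm_sq_eq_normSq v]
  exact (normSq_mulVec_eq_norm X v.ofLp).symm.trans_le (h v.ofLp)

lemma opNorm_le_one_iff {X : Matrix ι ι ℂ} : opNorm X ≤ 1 ↔ SqBounded 1 X := by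
  simpa using opNorm_le_ofReal_iff zero_le_one (X := X)

lemma opNorm_sqrt_le_one_iff {X : Matrix ι ι ℂ} : opNorm X ^ (1 / 2 : ℝ) ≤ 1 ↔ SqBounded 1 X := by
  rw [← opNorm_le_one_iff]
  refine ⟨fun h => ?_, fun h => ENNReal.rpow_le_one h (by norm_num)⟩
  by_contra! h'
  exact absurd (ENNReal.one_lt_rpow h' (by norm_num : (0 : ℝ) < 1 / 2)) (not_lt.mpr h)

end OpNorm

/-! ### Rows and columns of operators. -/

section Stack

/-- The column with blocks `A i`. -/
def colStack (A : μ → Matrix ι κ ℂ) : Matrix (μ × ι) κ ℂ := Matrix.of fun x k => A x.1 x.2 k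

/-- The row with blocks `A i`. -/
def rowStack (A : μ → Matrix ι κ ℂ) : Matrix ι (μ × κ) ℂ := Matrix.of fun i x => A x.1 i x.2

lemma colStack_gram (A : μ → Matrix ι κ ℂ) : (colStack A)ᴴ * colStack A = ∑ i, (A i)ᴴ * A i := by
  ext k l
  simp [Matrix.mul_apply, colStack, Fintype.sum_prod_type, Matrix.sum_apply]

lemma rowStack_gram (A : μ → Matrix ι κ ℂ) : rowStack A * (rowStack A)ᴴ = ∑ i, A i * (A i)ᴴ := by
  ext k l
  simp [Matrix.mul_apply, rowStack, Fintype.sum_prod_type, Matrix.sum_apply]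

lemma normSq_colStack (A : μ → Matrix ι κ ℂ) (v : κ → ℂ) :
    normSq (colStack A *ᵥ v) = ∑ i, normSq (A i *ᵥ v) := by
  rw [normSq_prod]; rfl

lemma sqBounded_colStack_iff (A : μ → Matrix ι κ ℂ) :
    SqBounded 1 (∑ i, (A i)ᴴ * A i) ↔ SqBounded 1 (colStack A) := by
  rw [← colStack_gram, sqBounded_one_iff_gram]

lemma sqBounded_rowStack_iff (A : μ → Matrix ι κ ℂ) :
    SqBounded 1 (∑ i, A i * (A i)ᴴ) ↔ SqBounded 1 (rowStack A) := by
  rw [← rowStack_gram]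
  have := sqBounded_one_iff_gram (X := (rowStack A)ᴴ)
  rw [conjTranspose_conjTranspose] at this
  rw [this]
  exact ⟨fun h => by simpa using h.conjTranspose zero_le_one, fun h => h.conjTranspose zero_le_one⟩

end Stack

end SqBounded

/-! ### Complete contractions with values in rectangular matrices -/

section CompleteContraction

variable {V W : Type*} [AddCommGroup V] [Module ℂ V] [AddCommGroup W] [Module ℂ W]
variable {P P' Q Q' : Type*} [Fintype P'] [Fintype Q'] [Fintype P] [Fintype Q]

/-- `T : V → M_{P,P'}` is a complete contraction. -/
def IsCompleteContraction (NV : MatrixNorms V) (T : V →ₗ[ℂ] Matrix P P' ℂ) : Prop :=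
  ∀ (n : ℕ) (x : Matrix (Fin n) (Fin n) V), NV n x ≤ 1 →
    SqBounded 1 (Matrix.comp (Fin n) (Fin n) P P' ℂ (x.map T))

lemma cbNorm_le_one_iff [DecidableEq P] {NV : MatrixNorms V} {T : V →ₗ[ℂ] Matrix P P ℂ} :
    cbNorm NV (matNorms P) T ≤ 1 ↔ IsCompleteContraction NV T := by
  simp [cbNorm, matNorms, IsCompleteContraction, opNorm_le_one_iff]

/-- The map `T` into the upper right corner of a space of square matrices. -/
def cornerMap {N : Type*} (e : P ⊕ P' ≃ N) (T : V →ₗ[ℂ] Matrix P P' ℂ) : V →ₗ[ℂ] Matrix N N ℂ where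
  toFun v := (fromBlocks 0 (T v) 0 0).submatrix e.symm e.symm
  map_add' u v := by
    ext i j
    rcases hi : e.symm i with a | a <;> rcases hj : e.symm j with b | b <;> simp [hi, hj]
  map_smul' c v := by
    ext i j
    rcases hi : e.symm i with a | a <;> rcases hj : e.symm j with b | b <;> simp [hi, hj]

lemma IsCompleteContraction.cornerMap {N : Type*} [Fintype N] (e : P ⊕ P' ≃ N)
    {NV : MatrixNorms V} {T : V →ₗ[ℂ] Matrix P P' ℂ} (hT : IsCompleteContraction NV T) :
    IsCompleteContraction NV (cornerMap e T) := by
  intro n x hx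
  refine SqBounded.of_submatrix zero_le_one (f := Prod.map id (e ∘ Sum.inl))
    (g := Prod.map id (e ∘ Sum.inr))
    (Function.injective_id.prodMap (e.injective.comp Sum.inl_injective))
    (Function.injective_id.prodMap (e.injective.comp Sum.inr_injective)) ?_ ?_ ?_
  · rintro ⟨i, p⟩ ⟨j, q⟩ h
    rcases hp : e.symm p with a | a
    · exact absurd ⟨(i, a), by simp [← hp]⟩ h
    · rcases hq : e.symm q with b | b <;> simp [RankOneGames.cornerMap, hp, hq]
  · rintro ⟨i, p⟩ ⟨j, q⟩ h
    rcases hq : e.symm q with a | a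
    · rcases hp : e.symm p with b | b <;> simp [RankOneGames.cornerMap, hp, hq]
    · exact absurd ⟨(j, a), by simp [← hq]⟩ h
  · convert hT n x hx using 1
    ext ⟨i, p⟩ ⟨j, q⟩
    simp [RankOneGames.cornerMap]

/-- The linear map `v ⊗ w ↦ T v ⊗ S w` for rectangular matrices. -/
noncomputable def rectTensorMap (T : V →ₗ[ℂ] Matrix P P' ℂ) (S : W →ₗ[ℂ] Matrix Q Q' ℂ) :
    V ⊗[ℂ] W →ₗ[ℂ] Matrix (P × Q) (P' × Q') ℂ :=
  TensorProduct.lift ((Matrix.kroneckerMapBilinear (LinearMap.mul ℂ ℂ)).compl₁₂ T S)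

lemma rectTensorMap_tmul (T : V →ₗ[ℂ] Matrix P P' ℂ) (S : W →ₗ[ℂ] Matrix Q Q' ℂ) (v : V) (w : W)
    (x : P × Q) (y : P' × Q') :
    rectTensorMap T S (v ⊗ₜ w) x y = T v x.1 y.1 * S w x.2 y.2 := by
  simp [rectTensorMap]

lemma tensorMap_eq_rectTensorMap {p q : ℕ} (T : V →ₗ[ℂ] Matrix (Fin p) (Fin p) ℂ)
    (S : W →ₗ[ℂ] Matrix (Fin q) (Fin q) ℂ) : tensorMap T S = rectTensorMap T S := rfl

lemma tensorMap_cornerMap_apply {p q : ℕ} (e : P ⊕ P' ≃ Fin p) (e' : Q ⊕ Q' ≃ Fin q)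
    (T : V →ₗ[ℂ] Matrix P P' ℂ) (S : W →ₗ[ℂ] Matrix Q Q' ℂ) (u : V ⊗[ℂ] W) :
    (tensorMap (cornerMap e T) (cornerMap e' S) u).submatrix
      (Prod.map (e ∘ Sum.inl) (e' ∘ Sum.inl)) (Prod.map (e ∘ Sum.inr) (e' ∘ Sum.inr)) =
      rectTensorMap T S u := by
  induction u with
  | zero => simp
  | tmul v w =>
    ext x y
    rw [tensorMap_eq_rectTensorMap, submatrix_apply, rectTensorMap_tmul, rectTensorMap_tmul]
    simp [cornerMap]
  | add u v hu hv => rw [map_add, map_add, ← hu, ← hv]; rfl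

/-- The minimal norm tests only square targets, so both maps are placed in a corner, of which the
rectangular tensor is a block. The bound is returned as a real `c` because the minimal norm is an
extended number, not yet known to be finite. -/
theorem exists_sqBounded_rectTensorMap {NV : MatrixNorms V} {NW : MatrixNorms W}
    {T : V →ₗ[ℂ] Matrix P P' ℂ} {S : W →ₗ[ℂ] Matrix Q Q' ℂ} (hT : IsCompleteContraction NV T)
    (hS : IsCompleteContraction NW S) (u : V ⊗[ℂ] W) :
    ∃ c : ℝ, 0 ≤ c ∧ ENNReal.ofReal c ≤ minNorm NV NW u ^ 2 ∧
      SqBounded c (rectTensorMap T S u) := by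
  classical
  let e := Fintype.equivFin (P ⊕ P')
  let e' := Fintype.equivFin (Q ⊕ Q')
  set X := tensorMap (cornerMap e T) (cornerMap e' S) u with hX
  have h1 : opNorm X ≤ minNorm NV NW u := by
    refine le_iSup_of_le _ (le_iSup_of_le _ (le_iSup_of_le (cornerMap e T) (le_iSup_of_le
      (cornerMap e' S) (le_iSup_of_le ?_ (le_iSup_of_le ?_ le_rfl)))))
    · exact cbNorm_le_one_iff.mpr (hT.cornerMap e)
    · exact cbNorm_le_one_iff.mpr (hS.cornerMap e')
  have h2 := (sqBounded_norm X).submatrix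
    ((e.injective.comp Sum.inl_injective).prodMap (e'.injective.comp Sum.inl_injective))
    ((e.injective.comp Sum.inr_injective).prodMap (e'.injective.comp Sum.inr_injective))
  rw [hX, tensorMap_cornerMap_apply, ← hX] at h2
  refine ⟨_, by positivity, ?_, h2⟩
  rw [ENNReal.ofReal_pow (norm_nonneg _), ← opNorm_eq_ofReal]
  gcongr

end CompleteContraction

/-! ### Complete contractions on `S_1`, `R` and `C` -/

section TraceClass

variable {α : Type*} [Fintype α] [DecidableEq α]
variable {P P' : Type*} [Fintype P'] [Fintype P]

/-- The block matrix `∑ E_st ⊗ T(E_st)` of a map on `S_1`. -/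
def blockMatrix (T : Matrix α α ℂ →ₗ[ℂ] Matrix P P' ℂ) : Matrix (α × P) (α × P') ℂ :=
  Matrix.of fun x y => T (Matrix.single x.1 y.1 1) x.2 y.2

lemma map_apply_eq_sum_blockMatrix (T : Matrix α α ℂ →ₗ[ℂ] Matrix P P' ℂ) (c : Matrix α α ℂ)
    (p : P) (q : P') : T c p q = ∑ s, ∑ t, c s t * blockMatrix T (s, p) (t, q) := by
  conv_lhs => rw [Matrix.matrix_eq_sum_single c]
  simp only [map_sum, Matrix.sum_apply]
  refine Finset.sum_congr rfl fun s _ => Finset.sum_congr rfl fun t _ => ?_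
  rw [show Matrix.single s t (c s t) = c s t • Matrix.single s t (1 : ℂ) by simp]
  simp only [map_smul, Matrix.smul_apply, blockMatrix, Matrix.of_apply, smul_eq_mul]

/-- The map `c ↦ ∑ c_st X_st` on `S_1` with block matrix `X`. -/
def ofBlockMatrix (X : Matrix (α × P) (α × P') ℂ) : Matrix α α ℂ →ₗ[ℂ] Matrix P P' ℂ where
  toFun c := Matrix.of fun p q => ∑ s, ∑ t, c s t * X (s, p) (t, q)
  map_add' c d := by ext; simp [add_mul, Finset.sum_add_distrib]
  map_smul' r c := by ext; simp [Finset.mul_sum, mul_assoc]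

lemma ofBlockMatrix_single (X : Matrix (α × P) (α × P') ℂ) (s t : α) (p : P) (q : P') :
    ofBlockMatrix X (Matrix.single s t 1) p q = X (s, p) (t, q) := by
  simp [ofBlockMatrix, Matrix.single_apply, ite_and]

lemma blockMatrix_ofBlockMatrix (X : Matrix (α × P) (α × P') ℂ) :
    blockMatrix (ofBlockMatrix X) = X := by
  ext ⟨s, p⟩ ⟨t, q⟩
  simp only [blockMatrix, Matrix.of_apply, ofBlockMatrix_single]

lemma ofBlockMatrix_blockMatrix (T : Matrix α α ℂ →ₗ[ℂ] Matrix P P' ℂ) :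
    ofBlockMatrix (blockMatrix T) = T := by
  ext c p q
  rw [map_apply_eq_sum_blockMatrix, map_apply_eq_sum_blockMatrix, blockMatrix_ofBlockMatrix]

lemma s1Norms_le_one_iff {n : ℕ} {x : Matrix (Fin n) (Fin n) (Matrix α α ℂ)} :
    s1Norms α n x ≤ 1 ↔ IsCompleteContraction (matNorms α) (dualMatrixMap (x.map scalarPairing)) :=
  cbNorm_le_one_iff

lemma matNorms_le_one_iff {n : ℕ} {x : Matrix (Fin n) (Fin n) (Matrix α α ℂ)} :
    matNorms α n x ≤ 1 ↔ SqBounded 1 (Matrix.comp _ _ _ _ ℂ x) := opNorm_le_one_iff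

/-- A map on `S_1` whose block matrix is a contraction is a complete contraction. -/
theorem isCompleteContraction_of_blockMatrix {T : Matrix α α ℂ →ₗ[ℂ] Matrix P P' ℂ}
    (h : SqBounded 1 (blockMatrix T)) : IsCompleteContraction (s1Norms α) T := by
  intro n x hx
  let e := Fintype.equivFin (P ⊕ P')
  -- An element `x` of the unit ball of `M_n(S_1)` is by definition a complete contraction on `M_α`.
  -- Apply it to the block matrix of `T`, read as a matrix over `M_α` and padded to a square one:
  -- the result contains the entries `T (x i j)`.
  let y : Matrix (Fin (Fintype.card (P ⊕ P'))) (Fin (Fintype.card (P ⊕ P'))) (Matrix α α ℂ) :=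
    Matrix.of fun p q => Matrix.of fun s t =>
      fromBlocks 0 (Matrix.of fun p q => blockMatrix T (s, p) (t, q)) 0 0 (e.symm p) (e.symm q)
  have hy : matNorms α _ y ≤ 1 := by
    rw [matNorms_le_one_iff]
    refine SqBounded.of_submatrix zero_le_one (f := Prod.map (e ∘ Sum.inl) id ∘ Prod.swap)
      (g := Prod.map (e ∘ Sum.inr) id ∘ Prod.swap)
      (((e.injective.comp Sum.inl_injective).prodMap Function.injective_id).comp
        Prod.swap_injective)
      (((e.injective.comp Sum.inr_injective).prodMap Function.injective_id).comp
        Prod.swap_injective) ?_ ?_ ?_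
    · rintro ⟨p, i⟩ ⟨q, j⟩ h
      rcases hp : e.symm p with a | a
      · exact absurd ⟨(i, a), by simp [← hp]⟩ h
      · rcases hq : e.symm q with b | b <;> simp [y, hp, hq]
    · rintro ⟨p, i⟩ ⟨q, j⟩ h
      rcases hq : e.symm q with a | a
      · rcases hp : e.symm p with b | b <;> simp [y, hp, hq]
      · exact absurd ⟨(j, a), by simp [← hq]⟩ h
    · convert h using 1
      ext ⟨i, p⟩ ⟨j, q⟩
      simp [y]
  have h1 := s1Norms_le_one_iff.mp hx _ y hy
  have h2 := h1.submatrix (f := Prod.map (e ∘ Sum.inl) id ∘ Prod.swap)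
      (g := Prod.map (e ∘ Sum.inr) id ∘ Prod.swap)
      (((e.injective.comp Sum.inl_injective).prodMap Function.injective_id).comp
        Prod.swap_injective)
      (((e.injective.comp Sum.inr_injective).prodMap Function.injective_id).comp
        Prod.swap_injective)
  convert h2 using 1
  ext ⟨i, p⟩ ⟨j, q⟩
  simp [y, dualMatrixMap, scalarPairing, map_apply_eq_sum_blockMatrix]

/-- The block matrix of a complete contraction on `S_1` is a contraction. -/
theorem IsCompleteContraction.blockMatrix {T : Matrix α α ℂ →ₗ[ℂ] Matrix P P' ℂ}
    (h : IsCompleteContraction (s1Norms α) T) : SqBounded 1 (blockMatrix T) := by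
  let e := Fintype.equivFin α
  -- The matrix of matrix units represents the identity map of `M_α` under the scalar pairing, hence
  -- lies in the unit ball; applying `T` entrywise produces the block matrix.
  let x : Matrix (Fin (Fintype.card α)) (Fin (Fintype.card α)) (Matrix α α ℂ) :=
    Matrix.of fun i j => Matrix.single (e.symm i) (e.symm j) 1
  have hx : s1Norms α _ x ≤ 1 := by
    rw [s1Norms_le_one_iff]
    intro n y hy
    rw [matNorms_le_one_iff] at hy
    convert hy.submatrix (f := Prod.map id e.symm) (g := Prod.map id e.symm)
      (Function.injective_id.prodMap e.symm.injective)
      (Function.injective_id.prodMap e.symm.injective) using 1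
    ext ⟨i, p⟩ ⟨j, q⟩
    simp [x, dualMatrixMap, scalarPairing, Matrix.single_apply, ite_and]
  convert (h _ x hx).submatrix (f := Prod.map e id) (g := Prod.map e id)
      (e.injective.prodMap Function.injective_id)
      (e.injective.prodMap Function.injective_id) using 1
  ext ⟨i, p⟩ ⟨j, q⟩
  simp [x, RankOneGames.blockMatrix]

end TraceClass

/-! ### Row and column spaces as spaces of operators. -/

section RowColumn

variable {κ : Type*} [Fintype κ]
variable {W : Type*} [AddCommGroup W] [Module ℂ W]

/-- The embedding of `R_κ` as rows. -/
def rowMap (κ : Type*) : (κ → ℂ) →ₗ[ℂ] Matrix Unit κ ℂ where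
  toFun v := Matrix.of fun _ k => v k
  map_add' _ _ := rfl
  map_smul' _ _ := rfl

/-- The embedding of `C_κ` as columns. -/
def colMap (κ : Type*) : (κ → ℂ) →ₗ[ℂ] Matrix κ Unit ℂ where
  toFun v := Matrix.of fun k _ => v k
  map_add' _ _ := rfl
  map_smul' _ _ := rfl

@[simp]
lemma rowMap_apply {κ : Type*} (v : κ → ℂ) (u : Unit) (k : κ) : rowMap κ v u k = v k := rfl

@[simp]
lemma colMap_apply {κ : Type*} (v : κ → ℂ) (k : κ) (u : Unit) : colMap κ v k u = v k := rfl

lemma rowNorms_le_one_iff {n : ℕ} {x : Matrix (Fin n) (Fin n) (κ → ℂ)} :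
    rowNorms κ n x ≤ 1 ↔ SqBounded 1 (rowStack fun i => x.map fun v => v i) := by
  rw [rowNorms, opNorm_sqrt_le_one_iff, sqBounded_rowStack_iff]

lemma colNorms_le_one_iff {n : ℕ} {x : Matrix (Fin n) (Fin n) (κ → ℂ)} :
    colNorms κ n x ≤ 1 ↔ SqBounded 1 (colStack fun i => x.map fun v => v i) := by
  rw [colNorms, opNorm_sqrt_le_one_iff, sqBounded_colStack_iff]

lemma isCompleteContraction_rowMap : IsCompleteContraction (rowNorms κ) (rowMap κ) := by
  intro n x hx
  rw [rowNorms_le_one_iff] at hx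
  exact hx.submatrix (f := Prod.fst) (g := Prod.swap) (fun _ _ h => by ext1; exacts [h, rfl])
    Prod.swap_injective

lemma isCompleteContraction_colMap : IsCompleteContraction (colNorms κ) (colMap κ) := by
  intro n x hx
  rw [colNorms_le_one_iff] at hx
  exact hx.submatrix (f := Prod.swap) (g := Prod.fst) Prod.swap_injective
    (fun _ _ h => by ext1; exacts [h, rfl])

variable [DecidableEq κ]

lemma map_eq_sum_single {M : Type*} [AddCommGroup M] [Module ℂ M] (T : (κ → ℂ) →ₗ[ℂ] M)
    (v : κ → ℂ) : T v = ∑ i, v i • T (Pi.single i 1) := by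
  conv_lhs => rw [pi_eq_sum_univ' v]
  simp [map_sum, Pi.single]

/-- Both `R_κ` and `C_κ`: to bound `‖∑ |i⟩ ⊗ a i‖` it suffices to test complete contractions on the
second factor. -/
lemma minNorm_single_le {N : MatrixNorms (κ → ℂ)} {NW : MatrixNorms W} {c : ℝ} (hc : 0 < c)
    (a : κ → W) (h : ∀ (q : ℕ) (S : W →ₗ[ℂ] Matrix (Fin q) (Fin q) ℂ),
      IsCompleteContraction NW S →
        N q (Matrix.of fun r s i => (c : ℂ)⁻¹ * S (a i) r s) ≤ 1) :
    minNorm N NW (∑ i, (Pi.single i 1 : κ → ℂ) ⊗ₜ[ℂ] a i) ≤ ENNReal.ofReal c := by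
  refine iSup_le fun p => iSup_le fun q => iSup_le fun T => iSup_le fun S => iSup_le fun hT =>
    iSup_le fun hS => ?_
  rw [cbNorm_le_one_iff] at hT hS
  -- After division by `c`, the matrix of coefficients of the `S (a i)` lies in the unit ball of the
  -- row or column space, so the complete contraction `T` may be applied to it.
  have h1 := (hT q _ (h q S hS)).smul (c : ℂ)
  rw [opNorm_le_ofReal_iff hc.le]
  refine (sqBounded_submatrix_equiv (Equiv.prodComm _ _) (Equiv.prodComm _ _)).mp ?_
  convert h1 using 1
  · simp
  ext ⟨r, i⟩ ⟨s, j⟩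
  have hc' : (c : ℂ) ≠ 0 := by exact_mod_cast hc.ne'
  simp only [map_sum, Matrix.sum_apply, submatrix_apply, tensorMap_eq_rectTensorMap,
    rectTensorMap_tmul, Matrix.smul_apply, Matrix.comp_apply, Matrix.map_apply, Matrix.of_apply]
  rw [map_eq_sum_single T]
  simp only [Matrix.sum_apply, Matrix.smul_apply, smul_eq_mul, Finset.mul_sum,
    Equiv.prodComm_apply, Prod.swap_prod_mk]
  refine Finset.sum_congr rfl fun k _ => ?_
  field_simp

end RowColumn

/-! ### Coordinates of `T ⊗ S`. -/

section ToTensor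

variable {α β : Type*} [Fintype α] [Fintype β] [DecidableEq α] [DecidableEq β]
variable {P P' Q Q' : Type*} [Fintype P] [Fintype P'] [Fintype Q] [Fintype Q']

lemma rectTensorMap_toTensor (T : Matrix α α ℂ →ₗ[ℂ] Matrix P P' ℂ)
    (S : Matrix β β ℂ →ₗ[ℂ] Matrix Q Q' ℂ) (X : Matrix (α × β) (α × β) ℂ) (x : P × Q)
    (y : P' × Q') : rectTensorMap T S (toTensor X) x y =
      ∑ a, ∑ a', ∑ b, ∑ b', X (a, b) (a', b') *
        (blockMatrix T (a, x.1) (a', y.1) * blockMatrix S (b, x.2) (b', y.2)) := by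
  simp only [toTensor, map_sum, Matrix.sum_apply, map_smul, Matrix.smul_apply, rectTensorMap_tmul,
    blockMatrix, Matrix.of_apply, smul_eq_mul]

end ToTensor

/-! ### Kraus decompositions -/

section Kraus

variable {m r N I : Type*} [Fintype m] [Fintype r] [Fintype I]

/-- The completely positive map `X ↦ ∑ K_i X K_iᴴ`. -/
def krausMap (K : I → Matrix m m ℂ) : Matrix m m ℂ →ₗ[ℂ] Matrix m m ℂ where
  toFun X := ∑ i, K i * X * (K i)ᴴ
  map_add' X Y := by simp [mul_add, add_mul, Finset.sum_add_distrib]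
  map_smul' c X := by simp [Finset.smul_sum]

lemma krausMap_apply (K : I → Matrix m m ℂ) (X : Matrix m m ℂ) (x y : m) :
    krausMap K X x y = ∑ i, ∑ k, ∑ l, K i x k * X k l * star (K i y l) := by
  simp only [krausMap, LinearMap.coe_mk, AddHom.coe_mk, Matrix.sum_apply, Matrix.mul_apply,
    conjTranspose_apply, Finset.sum_mul]
  exact Finset.sum_congr rfl fun i _ => Finset.sum_comm

/-- The operator `K` acting on the part `m` of a composite system `N ≃ m × r`. -/
noncomputable def liftVec (e : N ≃ m × r) (K : Matrix m m ℂ) (v : EuclideanSpace ℂ N) :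
    EuclideanSpace ℂ N :=
  WithLp.toLp 2 fun n => ∑ k, K (e n).1 k * v (e.symm (k, (e n).2))

lemma applyOn_krausMap_pureState (e : N ≃ m × r) (K : I → Matrix m m ℂ)
    (v : EuclideanSpace ℂ N) :
    applyOn e (krausMap K) (pureState v) = ∑ i, pureState (liftVec e (K i) v) := by
  ext x y
  simp only [applyOn, ampliate, submatrix_apply, Matrix.of_apply, krausMap_apply, pureState,
    Matrix.sum_apply, liftVec, star_sum, star_mul', Finset.sum_mul_sum]
  refine Finset.sum_congr rfl fun i _ => Finset.sum_congr rfl fun k _ =>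
    Finset.sum_congr rfl fun l _ => ?_
  ring

lemma applyOn_sum (e : N ≃ m × r) (T : Matrix m m ℂ →ₗ[ℂ] Matrix m m ℂ) (X : I → Matrix N N ℂ) :
    applyOn e T (∑ i, X i) = ∑ i, applyOn e T (X i) := by
  ext x y
  simp only [applyOn, ampliate, submatrix_apply, Matrix.of_apply, Matrix.sum_apply]
  rw [show (Matrix.of fun k l => ∑ i, X i (e.symm (k, (e x).2)) (e.symm (l, (e y).2))) =
      ∑ i, Matrix.of fun k l => X i (e.symm (k, (e x).2)) (e.symm (l, (e y).2)) by
    ext; simp [Matrix.sum_apply]]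
  simp [map_sum, Matrix.sum_apply]

variable [DecidableEq m]

lemma isQuantumOperation_krausMap {K : I → Matrix m m ℂ} (hK : ∑ i, (K i)ᴴ * K i = 1) :
    IsQuantumOperation (krausMap K) where
  completelyPositive n X hX := by
    have h : ampliate (krausMap K) X = ∑ i, (K i ⊗ₖ (1 : Matrix (Fin n) (Fin n) ℂ)) * X *
        (K i ⊗ₖ (1 : Matrix (Fin n) (Fin n) ℂ))ᴴ := by
      ext ⟨x, r⟩ ⟨y, s⟩
      simp only [ampliate, Matrix.of_apply, krausMap_apply, Matrix.sum_apply, Matrix.mul_apply,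
        conjTranspose_apply, kroneckerMap_apply, Fintype.sum_prod_type, Matrix.one_apply]
      refine Finset.sum_congr rfl fun i _ => ?_
      rw [Finset.sum_comm]
      simp [Finset.sum_mul, apply_ite (starRingEnd ℂ)]
    rw [h]
    exact posSemidef_sum _ fun i _ => hX.mul_mul_conjTranspose_same _
  tracePreserving X := by
    simp only [krausMap, LinearMap.coe_mk, AddHom.coe_mk, trace_sum]
    simp_rw [fun i => Matrix.trace_mul_cycle (K i) X (K i)ᴴ]
    rw [← trace_sum, ← Finset.sum_mul, hK, one_mul]

lemma posSemidef_one_sub_gram {K : Matrix r m ℂ} (h : SqBounded 1 K) :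
    (1 - Kᴴ * K).PosSemidef := by
  refine .of_dotProduct_mulVec_nonneg (by simp [IsHermitian]) fun v => ?_
  rw [sub_mulVec, dotProduct_sub, ← normSq_mulVec, one_mulVec, star_dotProduct_self,
    ← Complex.ofReal_sub]
  have := h v
  rw [one_mul] at this
  exact_mod_cast sub_nonneg.mpr this

open scoped MatrixOrder Matrix.Norms.L2Operator in
lemma exists_gram_eq {H : Matrix m m ℂ} (h : H.PosSemidef) : ∃ L : Matrix m m ℂ, H = Lᴴ * L := by
  obtain ⟨L, hL⟩ := CStarAlgebra.nonneg_iff_eq_star_mul_self.mp h.nonneg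
  exact ⟨L, hL⟩

/-- A contraction is one of the Kraus operators of a quantum operation. -/
theorem exists_isQuantumOperation_krausMap {K : Matrix m m ℂ} (h : SqBounded 1 K) :
    ∃ L : Fin 2 → Matrix m m ℂ, L 0 = K ∧ IsQuantumOperation (krausMap L) := by
  -- A square root of the defect `1 - Kᴴ K` is the second Kraus operator.
  obtain ⟨L, hL⟩ := exists_gram_eq (posSemidef_one_sub_gram h)
  exact ⟨![K, L], rfl, isQuantumOperation_krausMap (by simp [← hL])⟩

/-- Every quantum operation has a **Kraus decomposition**. -/
theorem IsQuantumOperation.exists_krausMap {T : Matrix m m ℂ →ₗ[ℂ] Matrix m m ℂ}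
    (hT : IsQuantumOperation T) :
    ∃ (n : ℕ) (K : Fin n → Matrix m m ℂ), T = krausMap K ∧ SqBounded 1 (colStack K) := by
  let e := Fintype.equivFin m
  -- The unnormalized maximally entangled vector: the ampliation of `|w⟩⟨w|` is the Choi matrix of
  -- `T`, and writing it as a sum of rank-one positive matrices gives the Kraus operators. The
  -- ancilla is relabelled by `e` because complete positivity is stated for `Fin n`.
  let w : m × Fin (Fintype.card m) → ℂ := fun x => if e x.1 = x.2 then 1 else 0
  have h1 := hT.completelyPositive _ _ (posSemidef_vecMulVec_self_star w)
  obtain ⟨n, v, hv⟩ := posSemidef_iff_eq_sum_vecMulVec.mp h1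
  let K : Fin n → Matrix m m ℂ := fun r => Matrix.of fun i a => v r (i, e a)
  have h2 : ∀ a b i j, T (Matrix.single a b 1) i j = ∑ r, K r i a * star (K r j b) := by
    intro a b i j
    have h3 : (Matrix.of fun i j => vecMulVec w (star w) (i, e a) (j, e b)) =
        Matrix.single a b (1 : ℂ) := by
      ext i j
      simp only [Matrix.of_apply, vecMulVec_apply, Pi.star_apply, w, Matrix.single_apply,
        EmbeddingLike.apply_eq_iff_eq]
      by_cases hi : i = a <;> by_cases hj : j = b <;>
        simp [hi, hj, Ne.symm]
    rw [← h3]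
    have := congrFun (congrFun hv (i, e a)) (j, e b)
    simpa [ampliate, Matrix.sum_apply, vecMulVec_apply, K] using this
  have hTK : T = krausMap K := by
    refine Matrix.ext_linearMap ℂ fun a b => LinearMap.ext_ring ?_
    ext i j
    simp only [LinearMap.comp_apply, Matrix.singleLinearMap_apply, h2, krausMap_apply]
    refine Finset.sum_congr rfl fun r _ => ?_
    simp [Matrix.single_apply, ite_and]
  refine ⟨n, K, hTK, (sqBounded_colStack_iff K).mp ?_⟩
  -- Trace preservation on matrix units, entry by entry.
  have : ∑ i, (K i)ᴴ * K i = 1 := by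
    ext b a
    have h3 := hT.tracePreserving (Matrix.single a b 1)
    simp only [Matrix.trace, Matrix.diag, h2] at h3
    rw [Finset.sum_comm] at h3
    simp only [Matrix.sum_apply, Matrix.mul_apply, conjTranspose_apply, mul_comm (star _)]
    rw [h3]
    simp [Matrix.single_apply, Matrix.one_apply, ite_and]
  rw [this]
  intro v
  simp

end Kraus

/-! ### Winning probabilities -/

namespace Game

variable {α β χ : Type*} [Fintype α] [Fintype β] [Fintype χ] (G : Game α β χ)
variable {E I : Type*} [Fintype E] [DecidableEq E] [Fintype I]

/-- The vector `(⟨γ| ⊗ 1) v` of the auxiliary system. -/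
noncomputable def overlap (v : EuclideanSpace ℂ ((α × β × χ) × E)) : E → ℂ :=
  fun z => ∑ x, star (G.γ x) * v (x, z)

/-- `|γ⟩⟨γ| ⊗ 1` factors through `⟨γ| ⊗ 1`, so its expectation in `v` is the squared norm of the
overlap. -/
lemma winProb_pureState (v : EuclideanSpace ℂ ((α × β × χ) × E)) :
    G.winProb (pureState v) = normSq (G.overlap v) := by
  have h : ((pureState G.γ ⊗ₖ (1 : Matrix E E ℂ)) * pureState v).trace =
      star (G.overlap v) ⬝ᵥ G.overlap v := by
    simp only [Matrix.trace, Matrix.diag, Matrix.mul_apply, kroneckerMap_apply, pureState,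
      Matrix.of_apply, Matrix.one_apply, dotProduct, overlap, Pi.star_apply, star_sum, star_mul',
      star_star, Finset.sum_mul_sum]
    rw [Fintype.sum_prod_type_right]
    refine Finset.sum_congr rfl fun z _ => Finset.sum_congr rfl fun x _ => ?_
    rw [Fintype.sum_prod_type]
    refine Finset.sum_congr rfl fun y _ => ?_
    simp only [mul_ite, ite_mul, mul_one, mul_zero, zero_mul, Finset.sum_ite_eq, Finset.mem_univ,
      if_true]
    ring
  rw [winProb, h, star_dotProduct_self, Complex.ofReal_re]

lemma winProb_sum (ρ : I → Matrix ((α × β × χ) × E) ((α × β × χ) × E) ℂ) :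
    G.winProb (∑ i, ρ i) = ∑ i, G.winProb (ρ i) := by
  simp [winProb, Finset.mul_sum, trace_sum]

lemma winProb_krausMap {m r : Type*} [Fintype m] [Fintype r] (e : (α × β × χ) × E ≃ m × r)
    (K : I → Matrix m m ℂ) (v : EuclideanSpace ℂ ((α × β × χ) × E)) :
    G.winProb (applyOn e (krausMap K) (pureState v)) =
      ∑ i, normSq (G.overlap (liftVec e (K i) v)) := by
  simp [applyOn_krausMap_pureState, winProb_sum, winProb_pureState]

lemma winProb_krausMap_krausMap {m r m' r' J : Type*} [Fintype m] [Fintype r] [Fintype m']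
    [Fintype r'] [Fintype J] (e : (α × β × χ) × E ≃ m × r) (e' : (α × β × χ) × E ≃ m' × r')
    (K : I → Matrix m m ℂ) (L : J → Matrix m' m' ℂ) (v : EuclideanSpace ℂ ((α × β × χ) × E)) :
    G.winProb (applyOn e' (krausMap L) (applyOn e (krausMap K) (pureState v))) =
      ∑ i, ∑ j, normSq (G.overlap (liftVec e' (L j) (liftVec e (K i) v))) := by
  simp [applyOn_krausMap_pureState, applyOn_sum, winProb_sum, winProb_pureState]

end Game

/-- Frees a supremum or an infimum from its square, so that it can be bounded term by term. -/
lemma sq_le_iff_le_rpow {a b : ℝ≥0∞} : a ^ 2 ≤ b ↔ a ≤ b ^ (2⁻¹ : ℝ) := by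
  rw [ENNReal.le_rpow_inv_iff (by norm_num : (0 : ℝ) < 2)]
  norm_cast

lemma SqBounded.of_unit {ι κ : Type*} [Fintype ι] [Fintype κ] {c : ℝ} {X : Matrix ι κ ℂ}
    (h : ∀ v, normSq v = 1 → normSq (X *ᵥ v) ≤ c) : SqBounded c X := by
  intro v
  rcases (normSq_nonneg v).eq_or_lt with h0 | h0
  · rw [normSq_eq_zero.mp h0.symm]
    simp [normSq_zero]
  · have hs := Real.sq_sqrt h0.le
    have h1 := h (((√(normSq v))⁻¹ : ℝ) • v) (by
      rw [← Complex.coe_smul, normSq_smul, Complex.norm_real, Real.norm_eq_abs, sq_abs, inv_pow, hs,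
        inv_mul_cancel₀ h0.ne'])
    rw [← Complex.coe_smul, mulVec_smul, normSq_smul, Complex.norm_real, Real.norm_eq_abs, sq_abs,
      inv_pow, hs, inv_mul_le_iff₀ h0] at h1
    linarith

/-- The transpose matches the amplitude operator of an entangled strategy, and unit vectors `v` play
the role of shared states. The case `c = ⊤` is trivial. -/
lemma opNorm_sq_le {ι : Type*} [Fintype ι] [DecidableEq ι] {X : Matrix ι ι ℂ} {c : ℝ≥0∞}
    (h : ∀ v, normSq v = 1 → ENNReal.ofReal (normSq (Xᵀ *ᵥ v)) ≤ c) : opNorm X ^ 2 ≤ c := by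
  rcases eq_or_ne c ⊤ with rfl | hc
  · exact le_top
  obtain ⟨d, rfl⟩ : ∃ d : NNReal, c = d := ⟨_, (ENNReal.coe_toNNReal hc).symm⟩
  have h1 : SqBounded (d : ℝ) Xᵀ := .of_unit fun v hv => by
    have := h v hv
    rwa [ENNReal.ofReal_le_coe] at this
  have h2 := h1.transpose d.coe_nonneg
  rw [transpose_transpose, ← Real.sq_sqrt d.coe_nonneg,
    ← opNorm_le_ofReal_iff (Real.sqrt_nonneg _)] at h2
  calc opNorm X ^ 2 ≤ ENNReal.ofReal (√d) ^ 2 := by gcongr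
    _ = (d : ℝ≥0∞) := by
      rw [← ENNReal.ofReal_pow (Real.sqrt_nonneg _), Real.sq_sqrt d.coe_nonneg]
      simp

namespace Game

variable {α β χ : Type*} [Fintype α] [Fintype β] [Fintype χ] [DecidableEq α] [DecidableEq β]
  (G : Game α β χ)

/-! ### The entangled value -/

section Entangled

variable {p q : ℕ}

lemma overlap_entangled_apply (K : Matrix (α × Fin p) (α × Fin p) ℂ)
    (L : Matrix (β × Fin q) (β × Fin q) ℂ) (φ : EuclideanSpace ℂ (Fin p × Fin q))
    (z : Fin p × Fin q) :
    G.overlap (liftVec (bobSplit α β χ (Fin p) (Fin q)) L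
      (liftVec (aliceSplit α β χ (Fin p) (Fin q)) K (tensorVec G.ψ φ))) z =
    ∑ y : Fin p × Fin q, (∑ a, ∑ a', ∑ b, ∑ b', G.M (a, b) (a', b') *
        (K (a', z.1) (a, y.1) * L (b', z.2) (b, y.2))) * φ y := by
  simp only [overlap, liftVec, bobSplit, aliceSplit, tensorVec, M, Matrix.of_apply,
    Equiv.coe_fn_mk, Equiv.coe_fn_symm_mk, Finset.mul_sum, Finset.sum_mul]
  simp only [← Fintype.sum_prod_type']
  let e : (α × β × χ) × ((β × Fin q) × (α × Fin p)) ≃ (Fin p × Fin q) × (α × α × β × β × χ) :=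
    { toFun := fun t => ((t.2.2.2, t.2.1.2), t.2.2.1, t.1.1, t.2.1.1, t.1.2.1, t.1.2.2)
      invFun := fun t => ((t.2.2.1, t.2.2.2.2.1, t.2.2.2.2.2), (t.2.2.2.1, t.1.2), (t.2.1, t.1.1))
      left_inv := fun _ => rfl
      right_inv := fun _ => rfl }
  refine Fintype.sum_equiv e _ _ fun t => ?_
  dsimp only [e, Equiv.coe_fn_mk]
  ring

/-- The dictionary between strategies and maps on `S_1`. The first index of `M_AB` comes from `ψ`
and meets the input of a Kraus operator, the second comes from `γ` and meets the output; hence the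
transposes. -/
lemma overlap_entangled (K : Matrix (α × Fin p) (α × Fin p) ℂ)
    (L : Matrix (β × Fin q) (β × Fin q) ℂ) (φ : EuclideanSpace ℂ (Fin p × Fin q)) :
    G.overlap (liftVec (bobSplit α β χ (Fin p) (Fin q)) L
      (liftVec (aliceSplit α β χ (Fin p) (Fin q)) K (tensorVec G.ψ φ))) =
    (rectTensorMap (ofBlockMatrix Kᵀ) (ofBlockMatrix Lᵀ) (toTensor G.M))ᵀ *ᵥ φ.ofLp := by
  ext z
  rw [overlap_entangled_apply]
  simp only [mulVec, dotProduct, transpose_apply, rectTensorMap_toTensor, blockMatrix_ofBlockMatrix]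

/-- The transposed column of Kraus operators on `AA'`, as the block matrix of a map on `S_1^A`. -/
def krausBlock {I P : Type*} (K : I → Matrix (α × P) (α × P) ℂ) :
    Matrix (α × P) (α × (I × P)) ℂ :=
  Matrix.of fun x y => K y.2.1 (y.1, y.2.2) x

lemma sqBounded_krausBlock {I P : Type*} [Fintype I] [Fintype P]
    {K : I → Matrix (α × P) (α × P) ℂ} (h : SqBounded 1 (colStack K)) :
    SqBounded 1 (krausBlock K) :=
by
  have := (h.transpose zero_le_one).submatrix (f := id)
    (g := fun y : α × (I × P) => (y.2.1, (y.1, y.2.2))) Function.injective_id fun y z h => by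
      simp only [Prod.mk.injEq] at h
      exact Prod.ext h.2.1 (Prod.ext h.1 h.2.2)
  exact this

theorem entangledValue_le :
    G.entangledValue ≤ minNorm (s1Norms α) (s1Norms β) (toTensor G.M) ^ 2 := by
  refine iSup_le fun p => iSup_le fun q => iSup_le fun φ => iSup_le fun T => iSup_le fun S =>
    iSup_le fun hφ => iSup_le fun hT => iSup_le fun hS => ?_
  obtain ⟨m, K, rfl, hK⟩ := hT.exists_krausMap
  obtain ⟨n, L, rfl, hL⟩ := hS.exists_krausMap
  rw [winProb_krausMap_krausMap]
  simp only [overlap_entangled]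
  -- All Kraus branches go into one rectangular complete contraction, the branch label being an
  -- extra column index, so the sum over branches becomes a single squared norm.
  set T' := ofBlockMatrix (krausBlock K)
  set S' := ofBlockMatrix (krausBlock L)
  have hT' : IsCompleteContraction (s1Norms α) T' := isCompleteContraction_of_blockMatrix
    (by rw [blockMatrix_ofBlockMatrix]; exact sqBounded_krausBlock hK)
  have hS' : IsCompleteContraction (s1Norms β) S' := isCompleteContraction_of_blockMatrix
    (by rw [blockMatrix_ofBlockMatrix]; exact sqBounded_krausBlock hL)
  obtain ⟨c, hc, hcm, hb⟩ := exists_sqBounded_rectTensorMap hT' hS' (toTensor G.M)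
  refine le_trans (ENNReal.ofReal_le_ofReal ?_) hcm
  have h1 := hb.transpose hc φ.ofLp
  rw [← norm_sq_eq_normSq φ, hφ, one_pow, mul_one] at h1
  refine le_of_eq_of_le ?_ h1
  simp only [normSq, ← Fintype.sum_prod_type']
  let e : Fin m × Fin n × Fin p × Fin q ≃ (Fin m × Fin p) × (Fin n × Fin q) :=
    { toFun := fun t => ((t.1, t.2.2.1), (t.2.1, t.2.2.2))
      invFun := fun t => (t.1.1, t.2.1, t.1.2, t.2.2)
      left_inv := fun _ => rfl
      right_inv := fun _ => rfl }
  refine Fintype.sum_equiv e _ _ fun t => ?_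
  simp only [mulVec, dotProduct, transpose_apply, rectTensorMap_toTensor,
    blockMatrix_ofBlockMatrix, T', S']
  rfl

theorem le_entangledValue :
    minNorm (s1Norms α) (s1Norms β) (toTensor G.M) ^ 2 ≤ G.entangledValue := by
  rw [sq_le_iff_le_rpow]
  refine iSup_le fun p => iSup_le fun q => iSup_le fun T => iSup_le fun S => iSup_le fun hT =>
    iSup_le fun hS => ?_
  rw [← sq_le_iff_le_rpow]
  refine opNorm_sq_le fun v hv => ?_
  rw [cbNorm_le_one_iff] at hT hS
  -- The transposed block matrices serve as the Kraus operators of index `0`. The branch `(0, 0)`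
  -- already attains the required amplitude and the others contribute nonnegative terms.
  obtain ⟨K, hK, hKq⟩ := exists_isQuantumOperation_krausMap (hT.blockMatrix.transpose zero_le_one)
  obtain ⟨L, hL, hLq⟩ := exists_isQuantumOperation_krausMap (hS.blockMatrix.transpose zero_le_one)
  have hv' : ‖WithLp.toLp 2 v‖ = 1 := by
    rw [← sq_eq_sq₀ (norm_nonneg _) zero_le_one, normSq_toLp, hv, one_pow]
  refine le_trans ?_ (le_iSup_of_le p (le_iSup_of_le q (le_iSup_of_le (WithLp.toLp 2 v)
    (le_iSup_of_le (krausMap K) (le_iSup_of_le (krausMap L) (le_iSup_of_le hv' (le_iSup_of_le hKq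
    (le_iSup_of_le hLq le_rfl))))))))
  refine ENNReal.ofReal_le_ofReal ?_
  rw [winProb_krausMap_krausMap]
  refine le_trans ?_ (Finset.single_le_sum (f := fun i => ∑ j, normSq (G.overlap
    (liftVec (bobSplit α β χ (Fin p) (Fin q)) (L j) (liftVec (aliceSplit α β χ (Fin p) (Fin q))
      (K i) (tensorVec G.ψ (WithLp.toLp 2 v)))))) (fun i _ => Finset.sum_nonneg fun j _ =>
        normSq_nonneg _) (Finset.mem_univ 0))
  refine le_trans ?_ (Finset.single_le_sum (f := fun j => normSq (G.overlap
    (liftVec (bobSplit α β χ (Fin p) (Fin q)) (L j) (liftVec (aliceSplit α β χ (Fin p) (Fin q))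
      (K 0) (tensorVec G.ψ (WithLp.toLp 2 v)))))) (fun j _ => normSq_nonneg _) (Finset.mem_univ 0))
  rw [overlap_entangled, hK, hL, transpose_transpose, transpose_transpose,
    ofBlockMatrix_blockMatrix, ofBlockMatrix_blockMatrix, tensorMap_eq_rectTensorMap]

end Entangled

end Game

/-! ### The trace norm -/

section TraceNorm

variable {ι κ I : Type*} [Fintype ι] [Fintype κ] [Fintype I]

/-- Cauchy–Schwarz over the index `i` in each coordinate of the output. It merges a contractive
column into one test operator. -/
lemma sqBounded_sum_smul {W : I → Matrix ι κ ℂ} (hW : SqBounded 1 (colStack W)) (t : I → ℂ) :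
    SqBounded (normSq t) (∑ i, t i • W i) := by
  intro v
  have h1 := hW v
  rw [normSq_prod_right, one_mul] at h1
  calc normSq ((∑ i, t i • W i) *ᵥ v)
      ≤ ∑ x, normSq t * normSq fun i => (colStack W *ᵥ v) (i, x) := by
        refine Finset.sum_le_sum fun x _ => ?_
        refine le_of_eq_of_le ?_ (norm_dotProduct_sq_le _ _)
        congr 2
        simp only [mulVec, dotProduct, colStack, Matrix.of_apply, Matrix.sum_apply,
          Matrix.smul_apply, smul_eq_mul, Finset.sum_mul, Finset.mul_sum, mul_assoc]
        exact Finset.sum_comm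
    _ ≤ _ := by
      rw [← Finset.mul_sum]
      exact mul_le_mul_of_nonneg_left h1 (normSq_nonneg t)

variable [DecidableEq ι]

/-- Allows the trace to be evaluated in a basis of right singular vectors of `X`. -/
lemma trace_mul_eq_sum_inner {n : ℕ} (X W : Matrix ι ι ℂ)
    (b : OrthonormalBasis (Fin n) ℂ (EuclideanSpace ℂ ι)) :
    (X * W).trace = ∑ i, inner ℂ (b i) (toEuclideanLin W (toEuclideanLin X (b i))) := by
  rw [Matrix.trace_mul_comm]
  have h := LinearMap.trace_eq_sum_inner (toEuclideanLin W ∘ₗ toEuclideanLin X) b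
  simp only [LinearMap.comp_apply] at h
  rw [← h, toEuclideanLin_eq_toLin_orthonormal, ← Matrix.toLin_mul, Matrix.trace_toLin_eq]

lemma norm_toEuclideanLin_sq_le {c : ℝ} {W : Matrix ι ι ℂ} (h : SqBounded c W)
    (v : EuclideanSpace ℂ ι) : ‖toEuclideanLin W v‖ ^ 2 ≤ c * ‖v‖ ^ 2 := by
  rw [norm_sq_eq_normSq, norm_sq_eq_normSq]
  exact h v.ofLp

/-- The trace norm is the norm dual to the operator norm. -/
theorem exists_traceNorm_eq (X : Matrix ι ι ℂ) : ∃ s : ℝ, 0 ≤ s ∧ traceNorm X = ENNReal.ofReal s ∧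
    (∀ (c : ℝ) (W : Matrix ι ι ℂ), 0 ≤ c → SqBounded c W → ‖(X * W).trace‖ ^ 2 ≤ s ^ 2 * c) ∧
    ∃ W : Matrix ι ι ℂ, SqBounded 1 W ∧ (X * W).trace = s := by
  set f := toEuclideanLin X with hf
  set n := Module.finrank ℂ (EuclideanSpace ℂ ι) with hn
  -- Right singular vectors: the `f (b i)` are pairwise orthogonal with norms `σ i`.
  set b := f.isSymmetric_adjoint_comp_self.eigenvectorBasis hn.symm with hb
  set σ : Fin n → ℝ := fun i => f.singularValues i with hσ
  have hσ0 : ∀ i, 0 ≤ σ i := fun i => f.singularValues_nonneg i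
  have hsum : (f.singularValues.sum fun _ s => s) = ∑ i, σ i := by
    rw [Finsupp.sum_of_support_subset _ (s := Finset.range n) _ _ (by simp), Finset.sum_range]
    intro i hi
    by_contra hi'
    exact (Finsupp.mem_support_iff.mp hi)
      (f.singularValues_of_finrank_le (by simpa [n] using hi'))
  have hinner : ∀ i j, inner ℂ (f (b i)) (f (b j)) = if i = j then ((σ i : ℂ) ^ 2) else 0 := by
    intro i j
    rw [← LinearMap.adjoint_inner_right, ← LinearMap.comp_apply,
      f.isSymmetric_adjoint_comp_self.apply_eigenvectorBasis hn.symm, inner_smul_right,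
      ← f.sq_singularValues_fin hn.symm, orthonormal_iff_ite.mp b.orthonormal]
    split_ifs with h
    · subst h; simp [σ]
    · simp
  have hnorm : ∀ i, ‖f (b i)‖ = σ i := fun i => by
    have h := hinner i i
    rw [inner_self_eq_norm_sq_to_K, if_pos rfl] at h
    have h' : ‖f (b i)‖ ^ 2 = σ i ^ 2 := Complex.ofReal_injective (by simpa using h)
    exact (sq_eq_sq₀ (norm_nonneg _) (hσ0 i)).mp h'
  refine ⟨∑ i, σ i, Finset.sum_nonneg fun i _ => hσ0 i, by rw [traceNorm, hsum], ?_, ?_⟩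
  · intro c W hc hW
    have h1 : ‖(X * W).trace‖ ≤ √c * ∑ i, σ i := by
      rw [trace_mul_eq_sum_inner X W b, Finset.mul_sum]
      refine (norm_sum_le _ _).trans (Finset.sum_le_sum fun i _ => ?_)
      refine (norm_inner_le_norm _ _).trans ?_
      rw [b.norm_eq_one, one_mul]
      refine le_of_sq_le_sq ?_ (mul_nonneg (Real.sqrt_nonneg _) (hσ0 i))
      rw [mul_pow, Real.sq_sqrt hc, ← hnorm]
      exact norm_toEuclideanLin_sq_le hW _
    calc _ ≤ _ := pow_le_pow_left₀ (norm_nonneg _) h1 2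
      _ = _ := by rw [mul_pow, Real.sq_sqrt hc]; ring
  -- The adjoint of the partial isometry in the polar decomposition, so that `g ∘ f` is diagonal
  -- with entries `σ i`. When `σ i = 0` the convention `0⁻¹ = 0` removes the term.
  · let g : EuclideanSpace ℂ ι →ₗ[ℂ] EuclideanSpace ℂ ι :=
      ∑ i, ((σ i : ℂ)⁻¹ • (innerSL ℂ (f (b i))).toLinearMap).smulRight (b i)
    have hg : ∀ v, g v = ∑ i, ((σ i : ℂ)⁻¹ * inner ℂ (f (b i)) v) • b i := fun v => by
      simp [g]
    have hgf : ∀ j, g (f (b j)) = (σ j : ℂ) • b j := fun j => by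
      rw [hg, Finset.sum_eq_single j]
      · rw [hinner, if_pos rfl]
        rcases eq_or_ne (σ j : ℂ) 0 with h | h
        · simp [h]
        · congr 1; field_simp
      · intro i _ hij
        rw [hinner, if_neg hij]; simp
      · simp
    refine ⟨toEuclideanLin.symm g, ?_, ?_⟩
    · intro v
      have h1 : normSq (toEuclideanLin.symm g *ᵥ v) = ‖g (WithLp.toLp 2 v)‖ ^ 2 := by
        rw [norm_sq_eq_normSq]
        conv_rhs => rw [← toEuclideanLin.apply_symm_apply g]
        rfl
      rw [h1, one_mul, ← normSq_toLp, hg]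
      have h2 : ‖∑ i, ((σ i : ℂ)⁻¹ * inner ℂ (f (b i)) (WithLp.toLp 2 v)) • b i‖ ^ 2 =
          ∑ i, ‖(σ i : ℂ)⁻¹ * inner ℂ (f (b i)) (WithLp.toLp 2 v)‖ ^ 2 := by
        rw [← b.sum_sq_norm_inner_right]
        refine Finset.sum_congr rfl fun i _ => ?_
        rw [b.orthonormal.inner_right_fintype]
      -- Contractivity of `g` is Bessel's inequality for the left singular vectors with `σ i ≠ 0`.
      have h3 : Orthonormal ℂ fun i : {i // σ i ≠ 0} => (σ i.1 : ℂ)⁻¹ • f (b i.1) := by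
        rw [orthonormal_iff_ite]
        intro i j
        rw [inner_smul_left, inner_smul_right, hinner]
        have : (σ i.1 : ℂ) ≠ 0 := by exact_mod_cast i.2
        by_cases h : i = j
        · subst h
          simp only [map_inv₀, Complex.conj_ofReal, if_true]
          field_simp
        · rw [if_neg (fun h' => h (Subtype.ext h')), if_neg h]; simp
      have h4 := h3.sum_inner_products_le (s := Finset.univ) (WithLp.toLp 2 v)
      rw [h2]
      refine le_of_eq_of_le ?_ h4
      rw [sum_eq_sum_comp_of_injective (f := fun i : {i // σ i ≠ 0} => i.1)
        Subtype.val_injective]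
      · refine Finset.sum_congr rfl fun i _ => ?_
        rw [inner_smul_left]
        simp
      · intro k hk
        have : σ k = 0 := by
          by_contra h
          exact hk ⟨⟨k, h⟩, rfl⟩
        simp [this]
    · rw [trace_mul_eq_sum_inner X _ b, LinearEquiv.apply_symm_apply]
      simp only [← hf, hgf, inner_smul_right, inner_self_eq_norm_sq_to_K, b.norm_eq_one]
      simp

end TraceNorm

namespace Game

variable {α β χ : Type*} [Fintype α] [Fintype β] [Fintype χ] [DecidableEq α] [DecidableEq β]
  (G : Game α β χ)

/-! ### The maximal value -/

section Maximal

variable {d : ℕ}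

/-- The action of `K` on `ABE` as a map from `AB` to `ABE`, with `E` initialized in `φ`. -/
noncomputable def restrictState (φ : EuclideanSpace ℂ (Fin d))
    (K : Matrix (α × β × Fin d) (α × β × Fin d) ℂ) (z : Fin d) : Matrix (α × β) (α × β) ℂ :=
  Matrix.of fun x y => ∑ k, K (x.1, x.2, z) (y.1, y.2, k) * φ k

lemma overlap_joint (K : Matrix (α × β × Fin d) (α × β × Fin d) ℂ)
    (φ : EuclideanSpace ℂ (Fin d)) (z : Fin d) :
    G.overlap (liftVec (jointSplit α β χ (Fin d)) K (tensorVec G.ψ φ)) z =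
      (G.M * restrictState φ K z).trace := by
  simp only [overlap, liftVec, jointSplit, tensorVec, M, Matrix.of_apply, restrictState,
    Equiv.coe_fn_mk, Equiv.coe_fn_symm_mk, Matrix.trace, Matrix.diag, Matrix.mul_apply,
    Finset.sum_mul, Finset.mul_sum]
  simp only [← Fintype.sum_prod_type']
  let e : (α × β × χ) × (α × β × Fin d) ≃ (α × β) × (α × β) × Fin d × χ :=
    { toFun := fun t => ((t.2.1, t.2.2.1), (t.1.1, t.1.2.1), t.2.2.2, t.1.2.2)
      invFun := fun t => ((t.2.1.1, t.2.1.2, t.2.2.2), (t.1.1, t.1.2, t.2.2.1))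
      left_inv := fun _ => rfl
      right_inv := fun _ => rfl }
  refine Fintype.sum_equiv e _ _ fun t => ?_
  dsimp only [e, Equiv.coe_fn_mk]
  ring

/-- Tensoring with the unit vector `φ` is an isometry, and the column of Kraus operators is a
contraction. -/
lemma sqBounded_colStack_restrictState {I : Type*} [Fintype I]
    {K : I → Matrix (α × β × Fin d) (α × β × Fin d) ℂ} (hK : SqBounded 1 (colStack K))
    {φ : EuclideanSpace ℂ (Fin d)} (hφ : ‖φ‖ = 1) :
    SqBounded 1 (colStack fun y : I × Fin d => restrictState φ (K y.1) y.2) := by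
  intro u
  let v : α × β × Fin d → ℂ := fun x => u (x.1, x.2.1) * φ x.2.2
  have hv : normSq v = normSq u := by
    have h : normSq φ.ofLp = 1 := by rw [← norm_sq_eq_normSq, hφ, one_pow]
    simp only [normSq] at h
    simp [normSq, v, Fintype.sum_prod_type, mul_pow, ← Finset.mul_sum, h]
  refine le_of_eq_of_le ?_ ((hK v).trans_eq (by rw [hv]))
  let e : (I × Fin d) × α × β ≃ I × α × β × Fin d :=
    { toFun := fun t => (t.1.1, t.2.1, t.2.2, t.1.2)
      invFun := fun t => ((t.1, t.2.2.2), t.2.1, t.2.2.1)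
      left_inv := fun _ => rfl
      right_inv := fun _ => rfl }
  refine Fintype.sum_equiv e _ _ fun t => ?_
  congr 2
  simp only [mulVec, dotProduct, colStack, Matrix.of_apply, restrictState, e, Equiv.coe_fn_mk, v,
    Fintype.sum_prod_type, Finset.sum_mul]
  exact Finset.sum_congr rfl fun a _ => Finset.sum_congr rfl fun b _ =>
    Finset.sum_congr rfl fun k _ => by ring

theorem maximalValue_le : G.maximalValue ≤ traceNorm G.M ^ 2 := by
  refine iSup_le fun d => iSup_le fun φ => iSup_le fun T => iSup_le fun hφ => iSup_le fun hT => ?_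
  obtain ⟨m, K, rfl, hK⟩ := hT.exists_krausMap
  rw [winProb_krausMap]
  obtain ⟨s, hs, hsM, hle, -⟩ := exists_traceNorm_eq G.M
  rw [hsM, ← ENNReal.ofReal_pow hs]
  refine ENNReal.ofReal_le_ofReal ?_
  set W : Fin m × Fin d → Matrix (α × β) (α × β) ℂ := fun y => restrictState φ (K y.1) y.2 with hW
  have hWb : SqBounded 1 (colStack W) := sqBounded_colStack_restrictState hK hφ
  set t : Fin m × Fin d → ℂ := fun y => (G.M * W y).trace with ht
  have h1 : ∑ i, normSq (G.overlap (liftVec (jointSplit α β χ (Fin d)) (K i)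
      (tensorVec G.ψ φ))) = normSq t := by
    rw [normSq_prod]
    refine Finset.sum_congr rfl fun i _ => congrArg normSq ?_
    ext z
    exact G.overlap_joint (K i) φ z
  -- The operator `∑ conj(t_y) W_y` has squared norm at most `|t|²` and pairs with `M_AB` to `|t|²`;
  -- duality gives `|t|⁴ ≤ s² |t|²`.
  have h2 : (G.M * ∑ y, star (t y) • W y).trace = (normSq t : ℂ) := by
    rw [← star_dotProduct_self]
    simp [Finset.mul_sum, trace_sum, dotProduct, ht]
  have h3 := hle _ _ (normSq_nonneg (star t)) (sqBounded_sum_smul hWb (star t))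
  simp only [Pi.star_apply] at h3
  rw [h2, Complex.norm_real, Real.norm_eq_abs, sq_abs, normSq_star] at h3
  rw [h1]
  rcases (normSq_nonneg t).eq_or_lt with h0 | h0
  · rw [← h0]; positivity
  · nlinarith

theorem le_maximalValue : traceNorm G.M ^ 2 ≤ G.maximalValue := by
  obtain ⟨s, hs, hsM, -, W, hW, hWs⟩ := exists_traceNorm_eq G.M
  -- A one-dimensional auxiliary system suffices: the optimal contraction itself is a Kraus
  -- operator.
  let e : α × β × Fin 1 ≃ α × β :=
    { toFun := fun t => (t.1, t.2.1)
      invFun := fun t => (t.1, t.2, 0)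
      left_inv := fun t => by ext <;> simp
      right_inv := fun _ => rfl }
  obtain ⟨K, hK, hKq⟩ := exists_isQuantumOperation_krausMap (hW.submatrix e.injective e.injective)
  have hφ : ‖EuclideanSpace.single (0 : Fin 1) (1 : ℂ)‖ = 1 := by simp
  refine le_trans ?_ (le_iSup_of_le 1 (le_iSup_of_le (EuclideanSpace.single (0 : Fin 1) (1 : ℂ))
    (le_iSup_of_le (krausMap K) (le_iSup_of_le hφ (le_iSup_of_le hKq le_rfl)))))
  rw [hsM, ← ENNReal.ofReal_pow hs, winProb_krausMap]
  refine ENNReal.ofReal_le_ofReal ?_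
  refine le_trans ?_ (Finset.single_le_sum (f := fun i => normSq (G.overlap
    (liftVec (jointSplit α β χ (Fin 1)) (K i) (tensorVec G.ψ (EuclideanSpace.single 0 1)))))
    (fun i _ => normSq_nonneg _) (Finset.mem_univ 0))
  have h1 : restrictState (EuclideanSpace.single (0 : Fin 1) (1 : ℂ)) (K 0) 0 = W := by
    ext x y
    simp [restrictState, hK, e]
  simp only [normSq, overlap_joint, Finset.univ_unique, Finset.sum_singleton, Fin.default_eq_zero]
  rw [h1, hWs]
  simp

end Maximal

end Game

/-- The scalar pairing of `X ∈ B(ℂ^α) ⊗ B(ℂ^β)` with `x ⊗ y`. -/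
def pairing {α β : Type*} [Fintype α] [Fintype β] (X : Matrix (α × β) (α × β) ℂ)
    (x : Matrix α α ℂ) (y : Matrix β β ℂ) : ℂ :=
  ∑ a, ∑ a', ∑ b, ∑ b', X (a, b) (a', b') * (x a a' * y b b')

namespace Game

variable {α β χ : Type*} [Fintype α] [Fintype β] [Fintype χ] [DecidableEq α] [DecidableEq β]
  (G : Game α β χ) {p : ℕ}

/-! ### The one-way value is at most the Haagerup norm -/

/-- The message basis state `k` links Alice's output to Bob's input and is summed coherently. Only
the columns of `K` with `A'` in the state `0` occur. -/
lemma overlap_oneWay (K : Matrix (α × Fin (p + 1)) (α × Fin (p + 1)) ℂ)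
    (L : Matrix (β × Fin (p + 1)) (β × Fin (p + 1)) ℂ) (z : Fin (p + 1)) :
    G.overlap (liftVec (receiverSplit α β χ (Fin (p + 1))) L
      (liftVec (senderSplit α β χ (Fin (p + 1))) K
        (tensorVec G.ψ (EuclideanSpace.single (0 : Fin (p + 1)) (1 : ℂ))))) z =
    ∑ k, pairing G.M (Matrix.of fun a a' => K (a', k) (a, 0))
      (Matrix.of fun b b' => L (b', z) (b, k)) := by
  have h : ∀ (a' : α) (k : Fin (p + 1)) (b : β) (c : χ), ∑ x : α × Fin (p + 1), K (a', k) x *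
      (G.ψ (x.1, b, c) * (EuclideanSpace.single (0 : Fin (p + 1)) (1 : ℂ)) x.2) =
      ∑ a, K (a', k) (a, 0) * G.ψ (a, b, c) := by
    intro a' k b c
    rw [Fintype.sum_prod_type]
    refine Finset.sum_congr rfl fun a _ => ?_
    simp
  simp only [overlap, liftVec, receiverSplit, senderSplit, tensorVec, M, Matrix.of_apply, pairing,
    Equiv.coe_fn_mk, Equiv.coe_fn_symm_mk, h, Finset.mul_sum, Finset.sum_mul]
  simp only [← Fintype.sum_prod_type']
  let e : (α × β × χ) × ((β × Fin (p + 1)) × α) ≃ Fin (p + 1) × α × α × β × β × χ :=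
    { toFun := fun t => (t.2.1.2, t.2.2, t.1.1, t.2.1.1, t.1.2.1, t.1.2.2)
      invFun := fun t => ((t.2.2.1, t.2.2.2.2.1, t.2.2.2.2.2), (t.2.2.2.1, t.1), t.2.1)
      left_inv := fun _ => rfl
      right_inv := fun _ => rfl }
  refine Fintype.sum_equiv e _ _ fun t => ?_
  dsimp only [e, Equiv.coe_fn_mk]
  ring

theorem oneWayValue_le :
    G.oneWayValue ≤ haagerupNorm (s1Norms α) (s1Norms β) (toTensor G.M) ^ 2 := by
  refine iSup_le fun p => iSup_le fun T => iSup_le fun S => iSup_le fun hT => iSup_le fun hS => ?_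
  obtain ⟨m, K, rfl, hK⟩ := hT.exists_krausMap
  obtain ⟨n, L, rfl, hL⟩ := hS.exists_krausMap
  rw [winProb_krausMap_krausMap, ← ENNReal.rpow_natCast]
  -- The square is moved to the other side so that an arbitrary decomposition of the tensor can be
  -- fixed.
  rw [← ENNReal.rpow_inv_le_iff (by norm_num)]
  refine le_iInf fun k => le_iInf fun a => le_iInf fun b => le_iInf fun hab => ?_
  rw [ENNReal.rpow_inv_le_iff (by norm_num), ENNReal.rpow_natCast, mul_pow]
  -- Alice's Kraus column with `A'` initialized in `0`: the resulting map on `S_1^A` takes values in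
  -- rows.
  let XA : Matrix (α × Unit) (α × (Fin m × Fin (p + 1))) ℂ :=
    (krausBlock K).submatrix (fun x => (x.1, 0)) id
  have hXA : SqBounded 1 XA := (sqBounded_krausBlock hK).submatrix
    (fun x y h => by ext1; exacts [(Prod.mk.inj h).1, rfl]) Function.injective_id
  have hTA : IsCompleteContraction (s1Norms α) (ofBlockMatrix XA) :=
    isCompleteContraction_of_blockMatrix (by rwa [blockMatrix_ofBlockMatrix])
  have hSB : IsCompleteContraction (s1Norms β) (ofBlockMatrix (krausBlock L)) :=
    isCompleteContraction_of_blockMatrix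
      (by rw [blockMatrix_ofBlockMatrix]; exact sqBounded_krausBlock hL)
  obtain ⟨c, hc, hcm, hA⟩ := exists_sqBounded_rectTensorMap
    (isCompleteContraction_rowMap (κ := Fin k)) hTA (∑ i, (Pi.single i 1 : Fin k → ℂ) ⊗ₜ[ℂ] a i)
  obtain ⟨d, hd, hdm, hB⟩ := exists_sqBounded_rectTensorMap
    (isCompleteContraction_colMap (κ := Fin k)) hSB (∑ i, (Pi.single i 1 : Fin k → ℂ) ⊗ₜ[ℂ] b i)
  refine le_trans ?_ (mul_le_mul' hcm hdm)
  rw [← ENNReal.ofReal_mul hc]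
  refine ENNReal.ofReal_le_ofReal ?_
  -- The rows `T_A(a_s)`, split by Alice's branch `i`. Their total squared norm is at most `c`; for
  -- fixed `i`, Bob's column operator carries `g i` to the amplitudes at a cost of at most `d`.
  let g : Fin m → Fin k × Fin (p + 1) → ℂ := fun i x => ofBlockMatrix XA (a x.1) () (i, x.2)
  have hg : ∑ i, normSq (g i) ≤ c := by
    have h1 := hA.transpose hc (fun _ => 1)
    have h2 : normSq (fun _ : Unit × Unit => (1 : ℂ)) = 1 := by simp [normSq]
    rw [h2, mul_one] at h1
    refine le_of_eq_of_le ?_ h1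
    simp only [normSq, ← Fintype.sum_prod_type']
    let e : Fin m × Fin k × Fin (p + 1) ≃ Fin k × (Fin m × Fin (p + 1)) :=
      { toFun := fun t => (t.2.1, t.1, t.2.2)
        invFun := fun t => (t.2.1, t.1, t.2.2)
        left_inv := fun _ => rfl
        right_inv := fun _ => rfl }
    refine Fintype.sum_equiv e _ _ fun t => ?_
    congr 2
    simp [mulVec, dotProduct, map_sum, Matrix.sum_apply, rectTensorMap_tmul, g, e,
      Pi.single_apply, Fintype.sum_prod_type]
  have hover : ∀ i, ∑ j, normSq (G.overlap (liftVec (receiverSplit α β χ (Fin (p + 1))) (L j)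
      (liftVec (senderSplit α β χ (Fin (p + 1))) (K i)
        (tensorVec G.ψ (EuclideanSpace.single (0 : Fin (p + 1)) (1 : ℂ)))))) ≤
      d * normSq (g i) := by
    intro i
    refine le_of_eq_of_le ?_ (hB.transpose hd (g i))
    simp only [normSq, ← Fintype.sum_prod_type']
    refine Fintype.sum_equiv (Equiv.punitProd _).symm _ _ fun t => ?_
    congr 2
    rw [overlap_oneWay]
    have h1 : ∀ l, pairing G.M (Matrix.of fun a a' => K i (a', l) (a, 0))
        (Matrix.of fun b b' => L t.1 (b', t.2) (b, l)) =
        rectTensorMap (ofBlockMatrix XA) (ofBlockMatrix (krausBlock L)) (toTensor G.M)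
          ((), l) ((i, l), t) := by
      intro l
      rw [rectTensorMap_toTensor, blockMatrix_ofBlockMatrix, blockMatrix_ofBlockMatrix]
      rfl
    simp only [h1, hab, map_sum, Matrix.sum_apply, rectTensorMap_tmul, mulVec, dotProduct,
      transpose_apply, Fintype.sum_prod_type, colMap_apply, g]
    rw [Finset.sum_comm]
    refine Finset.sum_congr rfl fun s _ => Finset.sum_congr rfl fun l _ => ?_
    simp [Pi.single_apply, mul_comm]
  calc _ ≤ ∑ i, d * normSq (g i) := Finset.sum_le_sum fun i _ => hover i
    _ = d * ∑ i, normSq (g i) := by rw [Finset.mul_sum]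
    _ ≤ d * c := mul_le_mul_of_nonneg_left hg hd
    _ = c * d := mul_comm _ _

/-! ### One-way strategies from families of operators -/

/-- Alice sends `i` coherently while acting by the transpose of `x i`; Bob acts by the transpose of
`y i` and returns the register to `0`. Transposition makes the row `x` a column out of the initial
state and the column `y` a row into the final one. The message register needs dimension at least
one, so the empty family is treated apart. -/
theorem ofReal_norm_sum_pairing_sq_le {n : ℕ} {x : Fin n → Matrix α α ℂ}
    {y : Fin n → Matrix β β ℂ} (hx : SqBounded 1 (rowStack x)) (hy : SqBounded 1 (colStack y)) :
    ENNReal.ofReal (‖∑ i, pairing G.M (x i) (y i)‖ ^ 2) ≤ G.oneWayValue := by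
  cases n with
  | zero => simp
  | succ p =>
  let K : Matrix (α × Fin (p + 1)) (α × Fin (p + 1)) ℂ :=
    Matrix.of fun s t => if t.2 = 0 then x s.2 t.1 s.1 else 0
  let L : Matrix (β × Fin (p + 1)) (β × Fin (p + 1)) ℂ :=
    Matrix.of fun s t => if s.2 = 0 then y t.2 t.1 s.1 else 0
  have hK : SqBounded 1 K := by
    refine SqBounded.of_submatrix zero_le_one (f := id) (g := fun a : α => (a, (0 : Fin (p + 1))))
      Function.injective_id (fun _ _ h => (Prod.mk.inj h).1) (by simp) ?_ ?_
    · rintro s ⟨a, k⟩ h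
      have hk : k ≠ 0 := fun hk => h ⟨a, by rw [hk]⟩
      simp [K, hk]
    · convert (hx.transpose zero_le_one).submatrix (f := Prod.swap) (g := id)
        Prod.swap_injective Function.injective_id using 1
      ext s t
      simp [K, rowStack]
  have hL : SqBounded 1 L := by
    refine SqBounded.of_submatrix zero_le_one (f := fun a : β => (a, (0 : Fin (p + 1)))) (g := id)
      (fun _ _ h => (Prod.mk.inj h).1) Function.injective_id ?_ (by simp) ?_
    · rintro ⟨a, k⟩ s h
      have hk : k ≠ 0 := fun hk => h ⟨a, by rw [hk]⟩
      simp [L, hk]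
    · convert (hy.transpose zero_le_one).submatrix (f := id) (g := Prod.swap)
        Function.injective_id Prod.swap_injective using 1
      ext s t
      simp [L, colStack]
  obtain ⟨K', hK', hKq⟩ := exists_isQuantumOperation_krausMap hK
  obtain ⟨L', hL', hLq⟩ := exists_isQuantumOperation_krausMap hL
  refine le_trans ?_ (le_iSup_of_le p (le_iSup_of_le (krausMap K') (le_iSup_of_le (krausMap L')
    (le_iSup_of_le hKq (le_iSup_of_le hLq le_rfl)))))
  refine ENNReal.ofReal_le_ofReal ?_
  rw [winProb_krausMap_krausMap]
  set F : Fin 2 → Fin 2 → Fin (p + 1) → ℂ := fun i j => G.overlap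
    (liftVec (receiverSplit α β χ (Fin (p + 1))) (L' j)
      (liftVec (senderSplit α β χ (Fin (p + 1))) (K' i)
        (tensorVec G.ψ (EuclideanSpace.single (0 : Fin (p + 1)) (1 : ℂ))))) with hF
  have h0 : F 0 0 0 = ∑ i, pairing G.M (x i) (y i) := by
    simp only [hF, overlap_oneWay, hK', hL']
    rfl
  calc _ = ‖F 0 0 0‖ ^ 2 := by rw [h0]
    _ ≤ normSq (F 0 0) := Finset.single_le_sum (f := fun z => ‖F 0 0 z‖ ^ 2)
      (fun _ _ => by positivity) (Finset.mem_univ 0)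
    _ ≤ ∑ j, normSq (F 0 j) := Finset.single_le_sum (f := fun j => normSq (F 0 j))
      (fun _ _ => normSq_nonneg _) (Finset.mem_univ 0)
    _ ≤ ∑ i, ∑ j, normSq (F i j) := Finset.single_le_sum (f := fun i => ∑ j, normSq (F i j))
      (fun _ _ => Finset.sum_nonneg fun _ _ => normSq_nonneg _) (Finset.mem_univ 0)

end Game

/-! ### Separation of the dual constraints -/

section Separation

variable {α β : Type*} [Fintype α] [Fintype β] [DecidableEq α] [DecidableEq β]

/-- The squared Hilbert–Schmidt norm. -/
noncomputable def hsSq {ι κ : Type*} [Fintype ι] [Fintype κ] (X : Matrix ι κ ℂ) : ℝ :=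
  ∑ i, ∑ j, ‖X i j‖ ^ 2

lemma hsSq_nonneg (X : Matrix α β ℂ) : 0 ≤ hsSq X :=
  Finset.sum_nonneg fun _ _ => Finset.sum_nonneg fun _ _ => by positivity

lemma hsSq_eq_trace (X : Matrix α β ℂ) : (hsSq X : ℂ) = (Xᴴ * X).trace := by
  rw [Matrix.trace, hsSq, Finset.sum_comm]
  simp [Matrix.mul_apply, Complex.conj_mul']

lemma hsSq_conjTranspose (X : Matrix α β ℂ) : hsSq Xᴴ = hsSq X := by
  rw [hsSq, hsSq, Finset.sum_comm]
  simp

lemma hsSq_one : hsSq (1 : Matrix α α ℂ) = Fintype.card α := by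
  simp [hsSq, Matrix.one_apply, apply_ite]

lemma re_quadForm_smul_one (r : ℝ) (v : α → ℂ) :
    (star v ⬝ᵥ (r • (1 : Matrix α α ℂ)) *ᵥ v).re = r * normSq v := by
  rw [smul_mulVec, one_mulVec, dotProduct_smul, star_dotProduct_self]
  simp

lemma re_quadForm_gram {ι : Type*} [Fintype ι] (x : Matrix ι α ℂ) (v : α → ℂ) :
    (star v ⬝ᵥ (xᴴ * x) *ᵥ v).re = normSq (x *ᵥ v) := by
  rw [← normSq_mulVec, Complex.ofReal_re]

/-- Pairs of matrices whose Hermitian parts are negative definite. -/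
def negativePairs (α β : Type*) [Fintype α] [Fintype β] :
    Set (Matrix α α ℂ × Matrix β β ℂ) :=
  {Z | ∃ δ : ℝ, 0 < δ ∧ (∀ v, (star v ⬝ᵥ Z.1 *ᵥ v).re ≤ -δ * normSq v) ∧
    ∀ v, (star v ⬝ᵥ Z.2 *ᵥ v).re ≤ -δ * normSq v}

open scoped Matrix.Norms.L2Operator in
lemma norm_quadForm_le (X : Matrix α α ℂ) (v : α → ℂ) :
    ‖star v ⬝ᵥ X *ᵥ v‖ ≤ ‖X‖ * normSq v := by
  have h := (sqBounded_norm X).norm_bilin_sq_le (star v) v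
  rw [normSq_star, l2_opNorm_toEuclideanCLM] at h
  refine le_of_sq_le_sq (h.trans_eq (by ring)) (mul_nonneg (norm_nonneg _) (normSq_nonneg _))

open scoped Matrix.Norms.L2Operator in
lemma re_quadForm_le_of_dist {X Y : Matrix α α ℂ} {δ : ℝ} (h : dist Y X < δ / 2)
    (hX : ∀ v, (star v ⬝ᵥ X *ᵥ v).re ≤ -δ * normSq v) (v : α → ℂ) :
    (star v ⬝ᵥ Y *ᵥ v).re ≤ -(δ / 2) * normSq v := by
  have h1 : star v ⬝ᵥ Y *ᵥ v = star v ⬝ᵥ X *ᵥ v + star v ⬝ᵥ (Y - X) *ᵥ v := by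
    rw [sub_mulVec, dotProduct_sub]; ring
  have h2 := (Complex.re_le_norm _).trans (norm_quadForm_le (Y - X) v)
  rw [dist_eq_norm] at h
  rw [h1, Complex.add_re]
  nlinarith [hX v, normSq_nonneg v]

open scoped Matrix.Norms.L2Operator in
-- The margin `δ` is uniform in `v`, and the quadratic form moves by at most `‖Y - X‖ ‖v‖²`; half
-- the margin survives.
lemma isOpen_negativePairs : IsOpen (negativePairs α β) := by
  rw [Metric.isOpen_iff]
  rintro Z ⟨δ, hδ, h1, h2⟩
  refine ⟨δ / 2, half_pos hδ, fun Y hY => ⟨δ / 2, half_pos hδ, ?_, ?_⟩⟩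
  · exact re_quadForm_le_of_dist ((le_max_left _ _).trans_lt hY) h1
  · exact re_quadForm_le_of_dist ((le_max_right _ _).trans_lt hY) h2

lemma convex_negativePairs : Convex ℝ (negativePairs α β) := by
  rintro Z ⟨δ, hδ, h1, h2⟩ Y ⟨ε, hε, h3, h4⟩ a b ha hb hab
  refine ⟨a * δ + b * ε, ?_, fun v => ?_, fun v => ?_⟩
  · rcases ha.eq_or_lt with rfl | ha
    · rw [zero_add] at hab; subst hab; simpa using hε
    · exact add_pos_of_pos_of_nonneg (mul_pos ha hδ) (mul_nonneg hb hε.le)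
  · simp only [Prod.fst_add, Prod.smul_fst, add_mulVec, smul_mulVec, dotProduct_add,
      dotProduct_smul, Complex.add_re, Complex.smul_re, smul_eq_mul]
    nlinarith [mul_le_mul_of_nonneg_left (h1 v) ha, mul_le_mul_of_nonneg_left (h3 v) hb]
  · simp only [Prod.snd_add, Prod.smul_snd, add_mulVec, smul_mulVec, dotProduct_add,
      dotProduct_smul, Complex.add_re, Complex.smul_re, smul_eq_mul]
    nlinarith [mul_le_mul_of_nonneg_left (h2 v) ha, mul_le_mul_of_nonneg_left (h4 v) hb]

/-- Arbitrarily large `s` is what later forces the separating functional to be nonnegative on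
positive pairs. -/
lemma neg_smul_sub_one_mem_negativePairs {H : Matrix α α ℂ} {H' : Matrix β β ℂ}
    (hH : H.PosSemidef) (hH' : H'.PosSemidef) {s : ℝ} (hs : 0 ≤ s) :
    (-(s • (H, H') + 1) : Matrix α α ℂ × Matrix β β ℂ) ∈ negativePairs α β := by
  refine ⟨1, one_pos, fun v => ?_, fun v => ?_⟩
  · have := (Complex.le_def.mp (hH.dotProduct_mulVec_nonneg v)).1
    simp only [Prod.fst_neg, Prod.fst_add, Prod.smul_fst, Prod.fst_one, neg_mulVec, add_mulVec,
      smul_mulVec, one_mulVec, dotProduct_neg, dotProduct_add, dotProduct_smul,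
      star_dotProduct_self, Complex.neg_re, Complex.add_re, Complex.smul_re, smul_eq_mul,
      Complex.ofReal_re]
    nlinarith [mul_nonneg hs this]
  · have := (Complex.le_def.mp (hH'.dotProduct_mulVec_nonneg v)).1
    simp only [Prod.snd_neg, Prod.snd_add, Prod.smul_snd, Prod.snd_one, neg_mulVec, add_mulVec,
      smul_mulVec, one_mulVec, dotProduct_neg, dotProduct_add, dotProduct_smul,
      star_dotProduct_self, Complex.neg_re, Complex.add_re, Complex.smul_re, smul_eq_mul,
      Complex.ofReal_re]
    nlinarith [mul_nonneg hs this]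

lemma pairing_smul_smul (X : Matrix (α × β) (α × β) ℂ) (c d : ℂ) (x : Matrix α α ℂ)
    (y : Matrix β β ℂ) : pairing X (c • x) (d • y) = c * d * pairing X x y := by
  simp only [pairing, Finset.mul_sum, Matrix.smul_apply, smul_eq_mul]
  refine Finset.sum_congr rfl fun a _ => Finset.sum_congr rfl fun a' _ =>
    Finset.sum_congr rfl fun b _ => Finset.sum_congr rfl fun b' _ => ?_
  ring

/-- The pair of constraints on a dual pair of states coming from `x ⊗ y`. -/
noncomputable def dualConstraint (X : Matrix (α × β) (α × β) ℂ) (w : ℝ)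
    (z : Matrix α α ℂ × Matrix β β ℂ) : Matrix α α ℂ × Matrix β β ℂ :=
  w • (z.1 * z.1ᴴ, z.2ᴴ * z.2) - (pairing X z.1 z.2).re • 1

/-- The constraint is quadratic in `z`, so scaling `z` by a square root makes the set of sums a
cone. -/
lemma dualConstraint_sqrt_smul (X : Matrix (α × β) (α × β) ℂ) (w : ℝ) {c : ℝ} (hc : 0 ≤ c)
    (z : Matrix α α ℂ × Matrix β β ℂ) :
    dualConstraint X w (((√c : ℝ) : ℂ) • z) = c • dualConstraint X w z := by
  have h : ((√c : ℝ) : ℂ) * ((√c : ℝ) : ℂ) = (c : ℂ) := by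
    rw [← Complex.ofReal_mul, Real.mul_self_sqrt hc]
  have h1 : pairing X (((√c : ℝ) : ℂ) • z.1) (((√c : ℝ) : ℂ) • z.2) = c * pairing X z.1 z.2 := by
    rw [pairing_smul_smul, h]
  simp only [dualConstraint, Prod.smul_fst, Prod.smul_snd, h1, conjTranspose_smul, smul_mul,
    Matrix.mul_smul, smul_smul, Complex.re_ofReal_mul, smul_sub, Complex.star_def,
    Complex.conj_ofReal, h]
  rw [Complex.coe_smul, Complex.coe_smul, ← Prod.smul_mk, smul_smul, mul_comm w c]

/-- The convex cone generated by the dual constraints. -/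
def constraintCone (X : Matrix (α × β) (α × β) ℂ) (w : ℝ) :
    Set (Matrix α α ℂ × Matrix β β ℂ) :=
  {Z | ∃ (n : ℕ) (z : Fin n → Matrix α α ℂ × Matrix β β ℂ), Z = ∑ i, dualConstraint X w (z i)}

lemma add_mem_constraintCone {X : Matrix (α × β) (α × β) ℂ} {w : ℝ}
    {Z Y : Matrix α α ℂ × Matrix β β ℂ} (hZ : Z ∈ constraintCone X w)
    (hY : Y ∈ constraintCone X w) : Z + Y ∈ constraintCone X w := by
  obtain ⟨n, z, rfl⟩ := hZ
  obtain ⟨m, y, rfl⟩ := hY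
  exact ⟨n + m, Fin.append z y, by simp [Fin.sum_univ_add]⟩

lemma smul_mem_constraintCone {X : Matrix (α × β) (α × β) ℂ} {w c : ℝ} (hc : 0 ≤ c)
    {Z : Matrix α α ℂ × Matrix β β ℂ} (hZ : Z ∈ constraintCone X w) :
    c • Z ∈ constraintCone X w := by
  obtain ⟨n, z, rfl⟩ := hZ
  refine ⟨n, fun i => ((√c : ℝ) : ℂ) • z i, ?_⟩
  simp only [dualConstraint_sqrt_smul X w hc, Finset.smul_sum]

lemma sum_dualConstraint (X : Matrix (α × β) (α × β) ℂ) (w : ℝ) {n : ℕ}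
    (z : Fin n → Matrix α α ℂ × Matrix β β ℂ) :
    ∑ i, dualConstraint X w (z i) =
      (w • ∑ i, (z i).1 * (z i).1ᴴ - (∑ i, pairing X (z i).1 (z i).2).re • 1,
        w • ∑ i, (z i).2ᴴ * (z i).2 - (∑ i, pairing X (z i).1 (z i).2).re • 1) := by
  ext1 <;> simp [dualConstraint, Prod.fst_sum, Prod.snd_sum, Finset.sum_sub_distrib,
    Finset.smul_sum, Finset.sum_smul]

/-- If a sum of constraints were negative definite, then `w ∑ x xᴴ` and `w ∑ yᴴ y` would both lie
below `R · 1`, with `R` the real part of the total pairing. Rescaling the family then makes it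
contractive with pairing of modulus at least `w`. Nonemptiness of `α` gives `R > 0`. -/
lemma disjoint_negativePairs_constraintCone [Nonempty α] {X : Matrix (α × β) (α × β) ℂ} {w : ℝ}
    (hw : ∀ (n : ℕ) (x : Fin n → Matrix α α ℂ) (y : Fin n → Matrix β β ℂ),
      SqBounded 1 (rowStack x) → SqBounded 1 (colStack y) →
        ‖∑ i, pairing X (x i) (y i)‖ < w) :
    Disjoint (negativePairs α β) (constraintCone X w) := by
  have hw0 : 0 < w := (norm_nonneg _).trans_lt (hw 0 0 0
    (fun v => by simp [normSq, mulVec, rowStack])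
    (fun v => by simpa [normSq] using normSq_nonneg v))
  rw [Set.disjoint_left]
  rintro _ ⟨δ, hδ, h1, h2⟩ ⟨n, z, rfl⟩
  rw [sum_dualConstraint] at h1 h2
  set s := ∑ i, pairing X (z i).1 (z i).2 with hs
  set R := s.re with hR
  have h1' : ∀ v, w * ∑ i, normSq ((z i).1ᴴ *ᵥ v) ≤ (R - δ) * normSq v := fun v => by
    have h3 : (star v ⬝ᵥ (∑ i, (z i).1 * (z i).1ᴴ) *ᵥ v).re = ∑ i, normSq ((z i).1ᴴ *ᵥ v) := by
      rw [sum_mulVec, dotProduct_sum, Complex.re_sum]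
      refine Finset.sum_congr rfl fun i _ => ?_
      rw [← re_quadForm_gram, conjTranspose_conjTranspose]
    have h4 := h1 v
    simp only [sub_mulVec, dotProduct_sub, Complex.sub_re, re_quadForm_smul_one] at h4
    rw [smul_mulVec, dotProduct_smul, Complex.smul_re, h3, smul_eq_mul] at h4
    linarith
  have h2' : ∀ v, w * ∑ i, normSq ((z i).2 *ᵥ v) ≤ (R - δ) * normSq v := fun v => by
    have h3 : (star v ⬝ᵥ (∑ i, (z i).2ᴴ * (z i).2) *ᵥ v).re = ∑ i, normSq ((z i).2 *ᵥ v) := by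
      rw [sum_mulVec, dotProduct_sum, Complex.re_sum]
      exact Finset.sum_congr rfl fun i _ => re_quadForm_gram _ _
    have h4 := h2 v
    simp only [sub_mulVec, dotProduct_sub, Complex.sub_re, re_quadForm_smul_one] at h4
    rw [smul_mulVec, dotProduct_smul, Complex.smul_re, h3, smul_eq_mul] at h4
    linarith
  have hRpos : 0 < R := by
    obtain ⟨a⟩ := ‹Nonempty α›
    have h := h1' (Pi.single a 1)
    have h3 : normSq (Pi.single a 1 : α → ℂ) = 1 := by simp [normSq, Pi.single_apply, apply_ite]
    rw [h3] at h
    have : 0 ≤ w * ∑ i, normSq ((z i).1ᴴ *ᵥ (Pi.single a 1)) :=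
      mul_nonneg hw0.le (Finset.sum_nonneg fun _ _ => normSq_nonneg _)
    linarith
  -- Scaling both factors by `√(w / R)` multiplies the Gram sums and the pairing by `w / R`.
  set c : ℂ := ((√(w / R) : ℝ) : ℂ) with hc
  have hcn : ‖c‖ ^ 2 = w / R := by
    rw [hc, Complex.norm_real, Real.norm_eq_abs, sq_abs, Real.sq_sqrt (by positivity)]
  have hcc : c * c = ((w / R : ℝ) : ℂ) := by
    rw [hc, ← Complex.ofReal_mul, Real.mul_self_sqrt (by positivity)]
  have key : ∀ {a b : ℝ}, 0 ≤ b → w * a ≤ (R - δ) * b → w / R * a ≤ b := fun {a b} hb h => by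
    rw [div_mul_eq_mul_div, div_le_iff₀ hRpos]
    nlinarith
  have hx : SqBounded 1 (rowStack fun i => c • (z i).1) := by
    have : SqBounded 1 (rowStack fun i => c • (z i).1)ᴴ := fun v => by
      rw [normSq_prod, one_mul]
      have h3 : ∀ i, normSq (fun k => ((rowStack fun i => c • (z i).1)ᴴ *ᵥ v) (i, k)) =
          w / R * normSq ((z i).1ᴴ *ᵥ v) := fun i => by
        rw [← hcn, ← norm_star c, ← normSq_smul, ← smul_mulVec, ← conjTranspose_smul]
        rfl
      simp only [h3, ← Finset.mul_sum]
      exact key (normSq_nonneg v) (h1' v)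
    simpa using this.conjTranspose zero_le_one
  have hy : SqBounded 1 (colStack fun i => c • (z i).2) := fun v => by
    rw [normSq_colStack, one_mul]
    simp only [smul_mulVec, normSq_smul, hcn, ← Finset.mul_sum]
    exact key (normSq_nonneg v) (h2' v)
  have h3 := hw n _ _ hx hy
  simp only [pairing_smul_smul, ← Finset.mul_sum, hcc, ← hs] at h3
  rw [norm_mul, Complex.norm_real, Real.norm_of_nonneg (by positivity)] at h3
  have h4 : R ≤ ‖s‖ := Complex.re_le_norm s
  have h5 : w / R * R ≤ w / R * ‖s‖ := mul_le_mul_of_nonneg_left h4 (by positivity)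
  rw [div_mul_cancel₀ _ hRpos.ne'] at h5
  linarith

/-- Dual pairs of (unnormalized) states: a bound on all contractive families is witnessed by a
pair of positive functionals. -/
theorem exists_dual_functional [Nonempty α] {X : Matrix (α × β) (α × β) ℂ} {w : ℝ}
    (hw : ∀ (n : ℕ) (x : Fin n → Matrix α α ℂ) (y : Fin n → Matrix β β ℂ),
      SqBounded 1 (rowStack x) → SqBounded 1 (colStack y) →
        ‖∑ i, pairing X (x i) (y i)‖ < w) :
    ∃ f : Matrix α α ℂ × Matrix β β ℂ →ₗ[ℝ] ℝ, 0 < f 1 ∧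
      (∀ H H', H.PosSemidef → H'.PosSemidef → 0 ≤ f (H, H')) ∧
      ∀ x y, (pairing X x y).re * f 1 ≤ w * f (x * xᴴ, yᴴ * y) := by
  obtain ⟨f, u, hfN, hfP⟩ := geometric_hahn_banach_open convex_negativePairs
    isOpen_negativePairs (s := negativePairs α β) (t := constraintCone X w)
    (fun Z hZ Y hY a b ha hb _ => add_mem_constraintCone (smul_mem_constraintCone ha hZ)
      (smul_mem_constraintCone hb hY)) (disjoint_negativePairs_constraintCone hw)
  have hu : u ≤ 0 := by simpa using hfP 0 ⟨0, 0, by simp⟩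
  have hN : ∀ H H' (s : ℝ), H.PosSemidef → H'.PosSemidef → 0 ≤ s →
      0 < s * f (H, H') + f 1 := fun H H' s hH hH' hs => by
    have := hfN _ (neg_smul_sub_one_mem_negativePairs hH hH' hs)
    rw [map_neg, map_add, map_smul, smul_eq_mul] at this
    linarith
  have h1 : 0 < f 1 := by simpa using hN 0 0 0 .zero .zero le_rfl
  refine ⟨f.toLinearMap, h1, fun H H' hH hH' => ?_, fun x y => ?_⟩
  · by_contra! h
    have h : f (H, H') < 0 := h
    -- This `s` makes `s f(H, H') + f 1` vanish, contradicting its positivity.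
    have := hN H H' (-(f 1) / f (H, H')) hH hH' (div_nonneg_of_nonpos (by linarith) h.le)
    rw [div_mul_cancel₀ _ h.ne] at this
    linarith
  · have hP : (dualConstraint X w (x, y)) ∈ constraintCone X w :=
      ⟨1, fun _ => (x, y), by simp⟩
    have h2 : 0 ≤ f (dualConstraint X w (x, y)) := by
      by_contra! h
      -- Scaling inside the cone to the value `u - 1` violates the separation bound `u`.
      have := hfP _ (smul_mem_constraintCone (c := (u - 1) / f (dualConstraint X w (x, y)))
        (div_nonneg_of_nonpos (by linarith) h.le) hP)
      rw [map_smul, smul_eq_mul, div_mul_cancel₀ _ h.ne] at this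
      linarith
    rw [dualConstraint, map_sub, map_smul, map_smul, smul_eq_mul, smul_eq_mul] at h2
    exact sub_nonneg.mp h2

/-- A positive functional, made strictly positive, is `x xᴴ ↦ ‖D x‖²` for an invertible `D`. -/
theorem exists_isUnit_hsSq_eq {f : Matrix α α ℂ →ₗ[ℝ] ℝ} (hf : ∀ H, H.PosSemidef → 0 ≤ f H)
    {ε : ℝ} (hε : 0 < ε) :
    ∃ D : Matrix α α ℂ, IsUnit D ∧
      ∀ x : Matrix α α ℂ, hsSq (D * x) = f (x * xᴴ) + ε * hsSq x := by
  -- Represents the real-linear `f` as `X ↦ Re tr(R X)`, which requires its values on both `E_ab`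
  -- and `i E_ab`.
  let R : Matrix α α ℂ := Matrix.of fun b a =>
    (f (Matrix.single a b 1) : ℂ) - Complex.I * f (Matrix.single a b Complex.I)
  have hR : ∀ X, ((R * X).trace).re = f X := fun X => by
    conv_rhs => rw [Matrix.matrix_eq_sum_single X]
    simp only [Matrix.trace, Matrix.diag, Matrix.mul_apply, map_sum, Complex.re_sum]
    rw [Finset.sum_comm]
    refine Finset.sum_congr rfl fun a _ => Finset.sum_congr rfl fun b _ => ?_
    have h : Matrix.single a b (X a b) = (X a b).re • Matrix.single a b (1 : ℂ) +
        (X a b).im • Matrix.single a b Complex.I := by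
      rw [smul_single, smul_single, ← single_add]
      congr 1
      simp
    rw [h, map_add, map_smul, map_smul]
    simp [R]
    ring
  -- On Hermitian matrices only the Hermitian part of `R` matters. Adding `ε` makes the density
  -- positive definite, so that `ρ = Dᴴ D` with `D` invertible.
  set ρ : Matrix α α ℂ := (2⁻¹ : ℂ) • (R + Rᴴ) + (ε : ℂ) • 1 with hρ
  have hρtr : ∀ H : Matrix α α ℂ, H.IsHermitian → (ρ * H).trace = f H + ε * H.trace := by
    intro H hH
    have h1 : (Rᴴ * H).trace = star (R * H).trace := by
      rw [← trace_conjTranspose, conjTranspose_mul, hH.eq, trace_mul_comm]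
    rw [hρ, add_mul, smul_mul, smul_mul, one_mul, trace_add, trace_smul, trace_smul, add_mul,
      trace_add, h1, ← hR H, Complex.star_def, Complex.add_conj]
    simp
  have hρq : ∀ v : α → ℂ, star v ⬝ᵥ ρ *ᵥ v =
      ((f (vecMulVec v (star v)) + ε * normSq v : ℝ) : ℂ) := by
    intro v
    have h1 : star v ⬝ᵥ ρ *ᵥ v = (ρ * vecMulVec v (star v)).trace := by
      rw [mul_vecMulVec, trace_vecMulVec, dotProduct_comm]
    rw [h1, hρtr _ (posSemidef_vecMulVec_self_star v).1, trace_vecMulVec, dotProduct_star_self]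
    simp
  have hρH : ρ.IsHermitian := by
    simp [IsHermitian, hρ, conjTranspose_smul, add_comm]
  have hρpd : ρ.PosDef := by
    refine .of_dotProduct_mulVec_pos hρH fun v hv => ?_
    rw [hρq]
    have h1 := hf _ (posSemidef_vecMulVec_self_star v)
    have h2 : 0 < normSq v := (normSq_nonneg v).lt_of_ne' (mt normSq_eq_zero.mp hv)
    exact_mod_cast add_pos_of_nonneg_of_pos h1 (mul_pos hε h2)
  obtain ⟨D, hD⟩ := exists_gram_eq hρpd.posSemidef
  refine ⟨D, ?_, fun x => ?_⟩
  · have h := hρpd.isUnit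
    rw [hD] at h
    rw [isUnit_iff_isUnit_det] at h ⊢
    rw [det_mul] at h
    exact isUnit_of_mul_isUnit_right h
  · have h1 : (hsSq (D * x) : ℂ) = f (x * xᴴ) + ε * hsSq x := by
      rw [hsSq_eq_trace, conjTranspose_mul, Matrix.mul_assoc, ← Matrix.mul_assoc Dᴴ, ← hD,
        trace_mul_comm, Matrix.mul_assoc, hρtr _ (isHermitian_mul_conjTranspose_self x),
        trace_mul_comm x, ← hsSq_eq_trace]
    exact_mod_cast h1

end Separation

/-! ### Factorization through Hilbert–Schmidt operators -/

section RowColumnBounds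

variable {κ W : Type*} [Fintype κ] [DecidableEq κ] [AddCommGroup W] [Module ℂ W]

lemma minNorm_row_le {NW : MatrixNorms W} {c : ℝ} (hc : 0 < c) (a : κ → W)
    (h : ∀ (q : ℕ) (S : W →ₗ[ℂ] Matrix (Fin q) (Fin q) ℂ), IsCompleteContraction NW S →
      ∀ v, ∑ i, normSq ((S (a i))ᴴ *ᵥ v) ≤ c ^ 2 * normSq v) :
    minNorm (rowNorms κ) NW (∑ i, (Pi.single i 1 : κ → ℂ) ⊗ₜ[ℂ] a i) ≤ ENNReal.ofReal c := by
  refine minNorm_single_le hc a fun q S hS => rowNorms_le_one_iff.mpr ?_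
  have h1 : SqBounded 1 (rowStack fun i => (c : ℂ)⁻¹ • S (a i))ᴴ := fun v => by
    rw [normSq_prod, one_mul]
    have h3 : ∀ i, normSq (fun k => ((rowStack fun i => (c : ℂ)⁻¹ • S (a i))ᴴ *ᵥ v) (i, k)) =
        (c ^ 2)⁻¹ * normSq ((S (a i))ᴴ *ᵥ v) := fun i => by
      have hn : (c ^ 2)⁻¹ = ‖star (c : ℂ)⁻¹‖ ^ 2 := by simp
      rw [hn, ← normSq_smul, ← smul_mulVec, ← conjTranspose_smul]
      rfl
    simp only [h3, ← Finset.mul_sum]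
    rw [inv_mul_le_iff₀ (by positivity)]
    exact h q S hS v
  have h2 := h1.conjTranspose zero_le_one
  rw [conjTranspose_conjTranspose] at h2
  exact h2

lemma minNorm_col_le {NW : MatrixNorms W} {c : ℝ} (hc : 0 < c) (a : κ → W)
    (h : ∀ (q : ℕ) (S : W →ₗ[ℂ] Matrix (Fin q) (Fin q) ℂ), IsCompleteContraction NW S →
      ∀ v, ∑ i, normSq (S (a i) *ᵥ v) ≤ c ^ 2 * normSq v) :
    minNorm (colNorms κ) NW (∑ i, (Pi.single i 1 : κ → ℂ) ⊗ₜ[ℂ] a i) ≤ ENNReal.ofReal c := by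
  refine minNorm_single_le hc a fun q S hS => colNorms_le_one_iff.mpr fun v => ?_
  have h3 : ∀ i, normSq (((c : ℂ)⁻¹ • S (a i)) *ᵥ v) = (c ^ 2)⁻¹ * normSq (S (a i) *ᵥ v) :=
    fun i => by
      rw [smul_mulVec, normSq_smul]
      simp
  have h4 := normSq_colStack (fun i => (c : ℂ)⁻¹ • S (a i)) v
  simp only [h3, ← Finset.mul_sum] at h4
  refine h4.trans_le ?_
  rw [inv_mul_le_iff₀ (by positivity), one_mul]
  exact h q S hS v

end RowColumnBounds

lemma haagerupNorm_le {V W : Type*} [AddCommGroup V] [Module ℂ V] [AddCommGroup W] [Module ℂ W]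
    {NV : MatrixNorms V} {NW : MatrixNorms W} {u : V ⊗[ℂ] W} {k : ℕ} {a : Fin k → V}
    {b : Fin k → W} (h : u = ∑ i, a i ⊗ₜ[ℂ] b i) :
    haagerupNorm NV NW u ≤
      minNorm (rowNorms (Fin k)) NV (∑ i, (Pi.single i 1 : Fin k → ℂ) ⊗ₜ[ℂ] a i) *
        minNorm (colNorms (Fin k)) NW (∑ i, (Pi.single i 1 : Fin k → ℂ) ⊗ₜ[ℂ] b i) :=
  iInf_le_of_le k (iInf_le_of_le a (iInf_le_of_le b (iInf_le_of_le h le_rfl)))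

section Factorization

variable {α β : Type*} [Fintype α] [Fintype β] [DecidableEq α] [DecidableEq β]

/-- The test vector `u = c⁻¹ conj(Xv)` balances the two squared norms: the inequality becomes `‖Xv‖²
/ c ≤ c ‖v‖²`. -/
lemma SqBounded.of_re_le {ι κ : Type*} [Fintype ι] [Fintype κ] {c : ℝ} (hc : 0 < c)
    {X : Matrix ι κ ℂ} (h : ∀ u v, (u ⬝ᵥ X *ᵥ v).re ≤ c / 2 * (normSq u + normSq v)) :
    SqBounded (c ^ 2) X := by
  intro v
  have h1 := h ((c : ℂ)⁻¹ • star (X *ᵥ v)) v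
  rw [smul_dotProduct, star_dotProduct_self, normSq_smul, normSq_star, smul_eq_mul,
    ← Complex.ofReal_inv, ← Complex.ofReal_mul, Complex.ofReal_re, Complex.norm_real,
    Real.norm_of_nonneg (by positivity)] at h1
  set S := normSq (X *ᵥ v)
  set N := normSq v
  have h2 : c / 2 * (c⁻¹ ^ 2 * S + N) = c⁻¹ * S / 2 + c / 2 * N := by field_simp
  rw [h2] at h1
  have h3 : c⁻¹ * S ≤ c * N := by linarith
  rw [inv_mul_le_iff₀ hc] at h3
  linarith

lemma normSq_tensor {ι κ : Type*} [Fintype ι] [Fintype κ] (u : ι → ℂ) (v : κ → ℂ) :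
    normSq (fun x : ι × κ => u x.1 * v x.2) = normSq u * normSq v := by
  simp [normSq, Fintype.sum_prod_type, mul_pow, Finset.sum_mul_sum]

lemma hsSq_eq_sum_normSq {ι κ : Type*} [Fintype ι] [Fintype κ] (X : Matrix ι κ ℂ) :
    hsSq X = ∑ i, normSq (X i) := rfl

/-- The row estimate: `‖∑ |s a'⟩ ⊗ Dᵀ E_{s a'}‖_{R ⊗_min S_1} ≤ ‖D‖_2`. -/
lemma sum_normSq_map_transpose_mul_single_le {q : ℕ}
    {S : Matrix α α ℂ →ₗ[ℂ] Matrix (Fin q) (Fin q) ℂ}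
    (hS : IsCompleteContraction (s1Norms α) S) (D : Matrix α α ℂ) (v : Fin q → ℂ) :
    ∑ i : α × α, normSq ((S (Dᵀ * Matrix.single i.1 i.2 1))ᴴ *ᵥ v) ≤ hsSq D * normSq v := by
  have hX := hS.blockMatrix.conjTranspose zero_le_one
  have h1 : ∀ s, ∑ a', normSq ((S (Dᵀ * Matrix.single s a' 1))ᴴ *ᵥ v) ≤
      normSq (D s) * normSq v := fun s => by
    -- On the product vector `conj(D s) ⊗ v`, the `a'`-component of the adjoint block matrix is `(S
    -- (Dᵀ E_{s a'}))ᴴ v`.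
    have h2 := hX (fun x => star (D s x.1) * v x.2)
    have h3 := normSq_tensor (star (D s)) v
    simp only [Pi.star_apply] at h3
    rw [h3, normSq_star, one_mul, normSq_prod] at h2
    refine le_of_eq_of_le (Finset.sum_congr rfl fun a' _ => congrArg normSq ?_) h2
    ext k
    simp only [mulVec, dotProduct, conjTranspose_apply, map_apply_eq_sum_blockMatrix S,
      Fintype.sum_prod_type, star_sum, star_mul', Finset.sum_mul]
    rw [Finset.sum_comm]
    refine Finset.sum_congr rfl fun a _ => Finset.sum_congr rfl fun r _ => ?_
    rw [Finset.sum_eq_single a']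
    · simp [Matrix.mul_apply, Matrix.single_apply, mul_comm, mul_left_comm]
    · intro t _ ht
      simp [Matrix.mul_apply, ht.symm]
    · simp
  rw [Fintype.sum_prod_type, hsSq_eq_sum_normSq, Finset.sum_mul]
  exact Finset.sum_le_sum fun s _ => h1 s

/-- The column estimate. -/
lemma sum_normSq_map_mulVec_le {κ : Type*} [Fintype κ] {q : ℕ}
    {S : Matrix β β ℂ →ₗ[ℂ] Matrix (Fin q) (Fin q) ℂ}
    (hS : IsCompleteContraction (s1Norms β) S) {c : ℝ} (hc : 0 ≤ c)
    {Λ : Matrix (β × β) κ ℂ} (hΛ : SqBounded c Λ) (F : Matrix β β ℂ) (v : Fin q → ℂ) :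
    ∑ i, normSq (S (Matrix.of fun b b' => ∑ t, F t b' * Λ (b, t) i) *ᵥ v) ≤
      c * hsSq F * normSq v := by
  set X := blockMatrix S with hX
  -- The block matrix acts on each row of `F` tensored with `v`; then `Λᵀ` acts for each output
  -- coordinate `r`. The two bounds multiply.
  let h : Fin q → β × β → ℂ := fun r x => (X *ᵥ fun y => F x.2 y.1 * v y.2) (x.1, r)
  have h1 : ∀ i r, (S (Matrix.of fun b b' => ∑ t, F t b' * Λ (b, t) i) *ᵥ v) r =
      (Λᵀ *ᵥ h r) i := fun i r => by
    simp only [mulVec, dotProduct, map_apply_eq_sum_blockMatrix S, ← hX, transpose_apply, h,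
      Matrix.of_apply, Finset.sum_mul, Finset.mul_sum]
    simp only [← Fintype.sum_prod_type']
    let e : Fin q × β × β × β ≃ (β × β) × (β × Fin q) :=
      { toFun := fun t => ((t.2.1, t.2.2.2), (t.2.2.1, t.1))
        invFun := fun t => (t.2.2, t.1.1, t.2.1, t.1.2)
        left_inv := fun _ => rfl
        right_inv := fun _ => rfl }
    refine Fintype.sum_equiv e _ _ fun t => ?_
    dsimp only [e, Equiv.coe_fn_mk]
    ring
  have h2 : ∑ r, normSq (h r) ≤ hsSq F * normSq v := by
    have h3 : ∑ r, normSq (h r) = ∑ t, normSq (X *ᵥ fun y => F t y.1 * v y.2) := by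
      simp only [normSq, h, ← Fintype.sum_prod_type']
      let e : Fin q × β × β ≃ β × β × Fin q :=
        { toFun := fun t => (t.2.2, t.2.1, t.1)
          invFun := fun t => (t.2.2, t.2.1, t.1)
          left_inv := fun _ => rfl
          right_inv := fun _ => rfl }
      exact Fintype.sum_equiv e _ _ fun t => rfl
    rw [h3, hsSq_eq_sum_normSq, Finset.sum_mul]
    refine Finset.sum_le_sum fun t _ => ?_
    rw [← normSq_tensor]
    exact (hS.blockMatrix _).trans_eq (one_mul _)
  calc _ = ∑ r, normSq (Λᵀ *ᵥ h r) := by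
        simp only [normSq, h1]
        exact Finset.sum_comm
    _ ≤ ∑ r, c * normSq (h r) := Finset.sum_le_sum fun r _ => hΛ.transpose hc _
    _ = c * ∑ r, normSq (h r) := by rw [Finset.mul_sum]
    _ ≤ c * (hsSq F * normSq v) := mul_le_mul_of_nonneg_left h2 hc
    _ = _ := by ring

lemma pairing_single_right (X : Matrix (α × β) (α × β) ℂ) (x : Matrix α α ℂ) (b b' : β) :
    pairing X x (Matrix.single b b' 1) = ∑ a, ∑ a', X (a, b) (a', b') * x a a' := by
  refine Finset.sum_congr rfl fun a _ => Finset.sum_congr rfl fun a' _ => ?_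
  simp [Matrix.single_apply, ite_and]

/-- `pairing` as a bilinear map. -/
noncomputable def pairingBilin (X : Matrix (α × β) (α × β) ℂ) :
    Matrix α α ℂ →ₗ[ℂ] Matrix β β ℂ →ₗ[ℂ] ℂ :=
  LinearMap.mk₂ ℂ (pairing X)
    (by intros; simp [pairing, add_mul, mul_add, Finset.sum_add_distrib])
    (by intros; simp [pairing, Finset.mul_sum, mul_left_comm, mul_assoc])
    (by intros; simp [pairing, mul_add, Finset.sum_add_distrib])
    (by intros; simp [pairing, Finset.mul_sum, mul_left_comm])

lemma pairingBilin_apply (X : Matrix (α × β) (α × β) ℂ) (x : Matrix α α ℂ) (y : Matrix β β ℂ) :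
    pairingBilin X x y = pairing X x y := rfl

lemma matrix_eq_sum_smul_single (x : Matrix α α ℂ) :
    x = ∑ i : α × α, x i.1 i.2 • Matrix.single i.1 i.2 (1 : ℂ) := by
  conv_lhs => rw [Matrix.matrix_eq_sum_single x]
  rw [Fintype.sum_prod_type]
  simp

/-- The decomposition of a tensor along an invertible `D` on the first factor. -/
lemma toTensor_eq_sum (X : Matrix (α × β) (α × β) ℂ) {D : Matrix α α ℂ} (hD : IsUnit D) :
    toTensor X = ∑ i : α × α, (Dᵀ * Matrix.single i.1 i.2 (1 : ℂ)) ⊗ₜ[ℂ]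
      (Matrix.of fun b b' => pairing X (D⁻¹ * Matrix.single i.1 i.2 1) (Matrix.single b b' 1)) := by
  have hB : ∀ i : α × α, (Matrix.of fun b b' => pairing X (D⁻¹ * Matrix.single i.1 i.2 1)
      (Matrix.single b b' (1 : ℂ))) = ∑ x : β × β, (∑ a, X (a, x.1) (i.2, x.2) * D⁻¹ a i.1) •
        Matrix.single x.1 x.2 (1 : ℂ) := fun i => by
    conv_lhs => rw [matrix_eq_sum_smul_single (Matrix.of _)]
    refine Finset.sum_congr rfl fun x _ => ?_
    congr 1
    rw [Matrix.of_apply, pairing_single_right]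
    refine Finset.sum_congr rfl fun a _ => ?_
    rw [Finset.sum_eq_single i.2]
    · simp [Matrix.mul_apply, Matrix.single_apply]
    · intro t _ ht
      simp [Matrix.mul_apply, ht.symm]
    · simp
  have hA : ∀ i : α × α, Dᵀ * Matrix.single i.1 i.2 (1 : ℂ) =
      ∑ a, D i.1 a • Matrix.single a i.2 (1 : ℂ) := fun i => by
    ext s t
    simp [Matrix.mul_apply, Matrix.sum_apply, Matrix.single_apply, ite_and]
  simp only [hA, hB, TensorProduct.sum_tmul, TensorProduct.tmul_sum, TensorProduct.smul_tmul_smul]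
  have hinv : ∀ a a', ∑ s, D⁻¹ a s * D s a' = if a = a' then 1 else 0 := fun a a' => by
    rw [← Matrix.mul_apply, Matrix.nonsing_inv_mul _ ((isUnit_iff_isUnit_det D).mp hD),
      Matrix.one_apply]
  have hcoef : ∀ a a' b b', X (a, b) (a', b') =
      ∑ s, D s a * ∑ a₁, X (a₁, b) (a', b') * D⁻¹ a₁ s := fun a a' b b' => by
    simp only [Finset.mul_sum]
    rw [Finset.sum_comm]
    have : ∀ a₁, ∑ s, D s a * (X (a₁, b) (a', b') * D⁻¹ a₁ s) =
        X (a₁, b) (a', b') * if a₁ = a then 1 else 0 := fun a₁ => by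
      rw [← hinv, Finset.mul_sum]
      exact Finset.sum_congr rfl fun s _ => by ring
    simp [this]
  rw [toTensor]
  conv_lhs =>
    enter [2, a, 2, a', 2, b, 2, b']
    rw [hcoef, Finset.sum_smul]
  simp only [← Fintype.sum_prod_type']
  let e : α × α × β × β × α ≃ (α × α) × (β × β) × α :=
    { toFun := fun t => ((t.2.2.2.2, t.2.1), (t.2.2.1, t.2.2.2.1), t.1)
      invFun := fun t => (t.2.2, t.1.2, t.2.1.1, t.2.1.2, t.1.1)
      left_inv := fun _ => rfl
      right_inv := fun _ => rfl }
  exact Fintype.sum_equiv e _ _ fun t => rfl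

/-- A bound on contractive families bounds the Haagerup norm. -/
theorem haagerupNorm_toTensor_le [Nonempty α] [Nonempty β] {X : Matrix (α × β) (α × β) ℂ} {w : ℝ}
    (hw : ∀ (n : ℕ) (x : Fin n → Matrix α α ℂ) (y : Fin n → Matrix β β ℂ),
      SqBounded 1 (rowStack x) → SqBounded 1 (colStack y) →
        ‖∑ i, pairing X (x i) (y i)‖ < w) {w' : ℝ} (hww' : w < w') :
    haagerupNorm (s1Norms α) (s1Norms β) (toTensor X) ≤ ENNReal.ofReal w' := by
  have hw0 : 0 < w := (norm_nonneg _).trans_lt (hw 0 0 0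
    (fun v => by simp [normSq, mulVec, rowStack])
    (fun v => by simpa [normSq] using normSq_nonneg v))
  obtain ⟨f, hf1, hf, hfX⟩ := exists_dual_functional hw
  set s := f 1 with hs
  set n : ℝ := Fintype.card α + Fintype.card β with hn
  have hα : (0 : ℝ) < Fintype.card α := by exact_mod_cast Fintype.card_pos
  have hβ : (0 : ℝ) < Fintype.card β := by exact_mod_cast Fintype.card_pos
  have hn0 : 0 < n := add_pos hα hβ
  -- Chosen so that `w (s + ε n) / s = w'`, the constant reached at the end.
  set ε : ℝ := (w' - w) * s / (w * n) with hε
  have hε0 : 0 < ε := div_pos (mul_pos (sub_pos.mpr hww') hf1) (mul_pos hw0 hn0)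
  obtain ⟨D, hD, hDx⟩ := exists_isUnit_hsSq_eq (f := f ∘ₗ LinearMap.inl ℝ _ _)
    (fun H hH => hf H 0 hH .zero) hε0
  obtain ⟨F, hF, hFx⟩ := exists_isUnit_hsSq_eq (f := f ∘ₗ LinearMap.inr ℝ _ _)
    (fun H hH => hf 0 H .zero hH) hε0
  have hDdet := (isUnit_iff_isUnit_det D).mp hD
  have hFdet := (isUnit_iff_isUnit_det F).mp hF
  have hsplit : ∀ H H', f (H, H') = f (H, 0) + f (0, H') := fun H H' => by
    rw [← map_add]; simp
  have hbound : ∀ x y, (pairing X x y).re * s ≤ w * (hsSq (D * x) + hsSq (F * yᴴ)) := by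
    intro x y
    refine (hfX x y).trans (mul_le_mul_of_nonneg_left ?_ hw0.le)
    rw [hDx, hFx, hsplit, conjTranspose_conjTranspose]
    have h1 := mul_nonneg hε0.le (hsSq_nonneg x)
    have h2 := mul_nonneg hε0.le (hsSq_nonneg yᴴ)
    simp only [LinearMap.comp_apply, LinearMap.inl_apply, LinearMap.inr_apply]
    linarith
  have hDF : hsSq D + hsSq F = s + ε * n := by
    have h1 := hDx 1
    have h2 := hFx 1
    simp only [mul_one, conjTranspose_one, hsSq_one, LinearMap.comp_apply, LinearMap.inl_apply,
      LinearMap.inr_apply] at h1 h2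
    rw [h1, h2, hs, show (1 : Matrix α α ℂ × Matrix β β ℂ) = (1, 1) from rfl, hsplit 1 1, hn]
    ring
  have hD0 : 0 < hsSq D := by
    have h1 := hDx 1
    rw [mul_one, hsSq_one] at h1
    rw [h1]
    exact add_pos_of_nonneg_of_pos (hf _ _ (by simpa using PosSemidef.one) .zero)
      (mul_pos hε0 hα)
  have hF0 : 0 < hsSq F := by
    have h1 := hFx 1
    rw [mul_one, hsSq_one] at h1
    rw [h1]
    exact add_pos_of_nonneg_of_pos (hf _ _ .zero (by simpa using PosSemidef.one))
      (mul_pos hε0 hβ)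
  -- Hilbert–Schmidt coordinates are `z = D x` and `q = y Fᴴ`, that is `x = D⁻¹ z` and `y = q E`;
  -- `Λ` is the matrix of the pairing in them.
  set E : Matrix β β ℂ := (F⁻¹)ᴴ with hE
  have hFE : Fᴴ * E = 1 := by
    rw [hE, ← conjTranspose_mul, Matrix.nonsing_inv_mul _ hFdet, conjTranspose_one]
  let Λ : Matrix (β × β) (α × α) ℂ := Matrix.of fun y x =>
    pairing X (D⁻¹ * Matrix.single x.1 x.2 1) (Matrix.single y.1 y.2 1 * E)
  -- Half of `c` is the factor `w / s` in front of `‖z‖² + ‖q‖²`, as `SqBounded.of_re_le` requires.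
  set c : ℝ := 2 * w / s with hc
  have hc0 : 0 < c := by positivity
  have hΛ : SqBounded (c ^ 2) Λ := by
    refine .of_re_le hc0 fun u v => ?_
    let z : Matrix α α ℂ := Matrix.of fun a a' => v (a, a')
    let q : Matrix β β ℂ := Matrix.of fun b b' => u (b, b')
    have h1 : u ⬝ᵥ Λ *ᵥ v = pairing X (D⁻¹ * z) (q * E) := by
      rw [matrix_eq_sum_smul_single z, matrix_eq_sum_smul_single q, Matrix.mul_sum,
        Matrix.sum_mul, ← pairingBilin_apply]
      simp only [map_sum, LinearMap.sum_apply, Matrix.mul_smul, Matrix.smul_mul, map_smul,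
        LinearMap.smul_apply, pairingBilin_apply, dotProduct, mulVec, smul_eq_mul, Finset.mul_sum]
      refine Finset.sum_congr rfl fun x _ => Finset.sum_congr rfl fun y _ => ?_
      simp only [Λ, z, q, Matrix.of_apply]
      ring
    have h2 := hbound (D⁻¹ * z) (q * E)
    rw [← h1, Matrix.mul_nonsing_inv_cancel_left _ _ hDdet, conjTranspose_mul, hE,
      conjTranspose_conjTranspose, Matrix.mul_nonsing_inv_cancel_left _ _ hFdet,
      hsSq_conjTranspose] at h2
    have h3 : hsSq z = normSq v := by simp [hsSq, normSq, z, Fintype.sum_prod_type]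
    have h4 : hsSq q = normSq u := by simp [hsSq, normSq, q, Fintype.sum_prod_type]
    rw [h3, h4, ← le_div_iff₀ hf1] at h2
    refine h2.trans_eq ?_
    rw [hc]
    ring
  -- Inserting `Fᴴ E = 1` after each matrix unit puts the second tensor factors in the form of the
  -- column estimate.
  have hBΛ : ∀ i : α × α, (Matrix.of fun b b' => pairing X (D⁻¹ * Matrix.single i.1 i.2 1)
      (Matrix.single b b' 1)) = Matrix.of fun b b' => ∑ t, (F.map star) t b' * Λ (b, t) i := by
    intro i
    ext b b'
    have h1 : Matrix.single b b' (1 : ℂ) =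
        ∑ t, star (F t b') • (Matrix.single b t (1 : ℂ) * E) := by
      conv_lhs => rw [← mul_one (Matrix.single b b' (1 : ℂ)), ← hFE, ← Matrix.mul_assoc]
      rw [show Matrix.single b b' (1 : ℂ) * Fᴴ = ∑ t, star (F t b') • Matrix.single b t (1 : ℂ) by
        ext x y
        simp [Matrix.mul_apply, Matrix.sum_apply, Matrix.single_apply, ite_and],
        Matrix.sum_mul]
      simp only [Matrix.smul_mul]
    simp only [Matrix.of_apply, Λ]
    rw [← pairingBilin_apply, h1, map_sum]
    simp only [map_smul, smul_eq_mul, pairingBilin_apply, Matrix.map_apply]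
  have hhsF : hsSq (F.map star) = hsSq F := by simp [hsSq]
  let e := Fintype.equivFin (α × α)
  let a : α × α → Matrix α α ℂ := fun i => Dᵀ * Matrix.single i.1 i.2 1
  let b : α × α → Matrix β β ℂ := fun i =>
    Matrix.of fun b b' => pairing X (D⁻¹ * Matrix.single i.1 i.2 1) (Matrix.single b b' 1)
  have hdec : toTensor X = ∑ i, a (e.symm i) ⊗ₜ[ℂ] b (e.symm i) := by
    rw [toTensor_eq_sum X hD]
    exact (Equiv.sum_comp e.symm fun i => a i ⊗ₜ[ℂ] b i).symm
  refine (haagerupNorm_le hdec).trans ?_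
  have hrow := minNorm_row_le (NW := s1Norms α) (Real.sqrt_pos.mpr hD0) (fun i => a (e.symm i))
    fun q S hS v => by
      rw [Real.sq_sqrt hD0.le, Equiv.sum_comp e.symm fun i => normSq ((S (a i))ᴴ *ᵥ v)]
      exact sum_normSq_map_transpose_mul_single_le hS D v
  have hcol := minNorm_col_le (NW := s1Norms β) (mul_pos hc0 (Real.sqrt_pos.mpr hF0))
    (fun i => b (e.symm i)) fun q S hS v => by
      rw [mul_pow, Real.sq_sqrt hF0.le, Equiv.sum_comp e.symm fun i => normSq (S (b i) *ᵥ v)]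
      simp only [b, hBΛ]
      rw [← hhsF]
      exact sum_normSq_map_mulVec_le hS (by positivity) hΛ (F.map star) v
  refine (mul_le_mul' hrow hcol).trans ?_
  rw [← ENNReal.ofReal_mul (Real.sqrt_nonneg _)]
  refine ENNReal.ofReal_le_ofReal ?_
  -- The arithmetic–geometric mean inequality replaces the product of row and column norms by `hsSq
  -- D + hsSq F`, known from evaluating `f` at the identity.
  have h1 : √(hsSq D) * √(hsSq F) ≤ (hsSq D + hsSq F) / 2 := by
    nlinarith [sq_nonneg (√(hsSq D) - √(hsSq F)), Real.sq_sqrt hD0.le, Real.sq_sqrt hF0.le]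
  calc √(hsSq D) * (c * √(hsSq F)) = c * (√(hsSq D) * √(hsSq F)) := by ring
    _ ≤ c * ((hsSq D + hsSq F) / 2) := mul_le_mul_of_nonneg_left h1 hc0.le
    _ = w' := by
      rw [hDF, hc, hε]
      field_simp
      ring

end Factorization

theorem Game.le_oneWayValue {α β χ : Type*} [Fintype α] [Fintype β] [Fintype χ] [DecidableEq α]
    [DecidableEq β] (G : Game α β χ) :
    haagerupNorm (s1Norms α) (s1Norms β) (toTensor G.M) ^ 2 ≤ G.oneWayValue := by
  -- A unit vector exists, so no register has dimension zero.
  have hne : Nonempty (α × β × χ) := by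
    by_contra h
    rw [not_nonempty_iff] at h
    have h1 := G.norm_ψ
    rw [Subsingleton.elim G.ψ 0, norm_zero] at h1
    exact zero_ne_one h1
  have : Nonempty α := hne.map fun x => x.1
  have : Nonempty β := hne.map fun x => x.2.1
  rw [sq_le_iff_le_rpow]
  refine le_of_forall_gt_imp_ge_of_dense fun c hc => ?_
  rcases eq_or_ne c ⊤ with rfl | hctop
  · exact le_top
  -- Two margins above the square root of the value: `d` gives the strict bound on contractive
  -- families, and the gap from `d` to `c` absorbs the perturbation `ε`.
  obtain ⟨d, hd, hdc⟩ := exists_between hc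
  rw [← ENNReal.ofReal_toReal hctop]
  refine haagerupNorm_toTensor_le (w := d.toReal) (fun n x y hx hy => ?_)
    ((ENNReal.toReal_lt_toReal hdc.ne_top hctop).mpr hdc)
  have h1 := G.ofReal_norm_sum_pairing_sq_le hx hy
  rw [ENNReal.ofReal_pow (norm_nonneg _), sq_le_iff_le_rpow] at h1
  exact (ENNReal.ofReal_lt_iff_lt_toReal (norm_nonneg _) hdc.ne_top).mp (h1.trans_lt hd)

end RankOneGames

theorem mainTheorem3 {α β χ : Type*} [Fintype α] [Fintype β] [Fintype χ]
    [DecidableEq α] [DecidableEq β] (G : RankOneGames.Game α β χ) :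
    G.entangledValue =
        RankOneGames.minNorm (RankOneGames.s1Norms α) (RankOneGames.s1Norms β)
          (RankOneGames.toTensor G.M) ^ 2 ∧
      G.oneWayValue =
        RankOneGames.haagerupNorm (RankOneGames.s1Norms α) (RankOneGames.s1Norms β)
          (RankOneGames.toTensor G.M) ^ 2 ∧
      G.maximalValue = RankOneGames.traceNorm G.M ^ 2 :=
  ⟨le_antisymm G.entangledValue_le G.le_entangledValue,
    le_antisymm G.oneWayValue_le G.le_oneWayValue,
    le_antisymm G.maximalValue_le G.le_maximalValue⟩
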